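/- **Theorem (L-extended unconstrained feature model with bias).** Let $L\ge 1$, let $d_0,\dots,d_{L-1}$ be natural numbers, $K=d_L$ the number of classes, $n_1,\dots,n_K\ge 1$ the class sizes, $\mathbf n=(n_1,\dots,n_K)^\top$, $N=\sum_k n_k$, $D=\mathrm{diag}(\sqrt{n_1},\dots,\sqrt{n_K})$, and let $\lambda_{W_1},\dots,\lambda_{W_L},\lambda_H>0$. Let $Y\in\mathbb R^{K\times N}$ be the matrix in which the column of every sample of class $k$ is the one-hot vector $e_k$. Let $(W_L,\dots,W_1,H,b)$, with $W_j\in\mathbb R^{d_j\times d_{j-1}}$, $H=[h_{k,i}]\in\mathbb R^{d_0\times N}$, $b\in\mathbb R^K$, be a global minimizer of $$\frac1{2N}\|W_L\cdots W_1H+b\mathbf 1_N^\top-Y\|_F^2+\frac12\sum_{j=1}^L\lambda_{W_j}\|W_j\|_F^2+\frac{\lambda_H}2\|H\|_F^2 .$$ Let $\bar H=[\bar h_1\ \cdots\ \bar h_K]$ with $\bar h_k=\frac1{n_k}\sum_i h_{k,i}$, and set $$\hat Y=\bigl(I_K-\tfrac1N\mathbf n\mathbf 1_K^\top\bigr)D,\quad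 r=\min(d_0,\dots,d_{L-1},K),\quad c=\frac{\lambda_{W_1}^{L-1}}{\lambda_{W_L}\cdots\lambda_{W_2}},\quad \Lambda=\sqrt[L]{N\lambda_{W_L}\cdots\lambda_{W_1}\lambda_H}.$$ For a singular value decomposition $\hat Y=\hat U\kappa\hat V^\top$ ($\hat U,\hat V$ orthogonal, $\kappa=\mathrm{diag}(\kappa_1,\dots,\kappa_K)$, $\kappa_1\ge\dots\ge\kappa_K\ge0$) write $\tau_k=\kappa_k^2(L-1)^{\frac{L-1}L}-\Lambda L^2N$ (with $0^0=1$). For a set $S\subseteq\{1,\dots,K\}$ of indices such that $k\le r$ and $\tau_k\ge 0$ for all $k\in S$, and such that $k\in S$ whenever $k\le r$ and $\tau_k>0$, define $$\sigma_k^2=\begin{cases}\sqrt[L]{N\lambda_H/c}\;x_k^*,&k\in S,\\0,&k\notin S,\end{cases}$$ where $x_k^*$ is the largest real solution of $\alpha_k-\frac{x^{L-1}}{(x^L+1)^2}=0$ with $\alpha_k=\frac{N}{\kappa_k^2}\Lambda$ (this solution exists), and put $$\Upsilon_1=\mathrm{diag}(\sigma_1^2,\dots,\sigma_K^2),\qquad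 \Upsilon_2=\mathrm{diag}\Bigl(\frac{\sigma_k^{2L}}{(c\sigma_k^{2L}+N\lambda_H)^2}\Bigr)_{k=1}^K .$$ Say that $(\hat U,\kappa,\hat V,S)$ *describes the minimizer* if $$\hat U^\top W_LW_L^\top\hat U=\frac{\lambda_{W_1}}{\lambda_{W_L}}\Upsilon_1,\qquad \hat U^\top W_L\cdots W_1W_1^\top\cdots W_L^\top\hat U=c\,\Upsilon_1^L,$$ $$\hat V^\top D\bar H^\top\bar HD\hat V=c\,\Upsilon_2\kappa^2,\qquad \hat U^\top W_L\cdots W_1\bar HD\hat V=c\,\Upsilon_2\,(c\Upsilon_1^L+N\lambda_HI)\,\kappa,$$ and, with $w_k^\top$ the $k$-th row of $\hat U^\top W_L\cdots W_1$ and $g_k$ the $k$-th column of $\bar HD\hat V$: for $k\in S$ both $w_k,g_k$ are nonzero and $\frac{w_k}{\|w_k\|_2}=\frac{g_k}{\|g_k\|_2}$, and for $k\notin S$, $w_k=g_k=0$. Then: 1. $h_{k,1}=\cdots=h_{k,n_k}$ for every $k=1,\dots,K$. 2. Every singular value decomposition $(\hat U,\kappa,\hat V)$ of $\hat Y$ with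 (i) if $L\ge2$, $\tau_k\ne0$ for all $k\le r$, and (ii) $\kappa_l\ne\kappa_k$ whenever $k\le r<l$ and $\tau_k>0$, describes the minimizer, with $S=\{k\le r:\tau_k>0\}$. 3. Without the conditions (i), (ii), there are a singular value decomposition $(\hat U,\kappa,\hat V)$ of $\hat Y$ and an admissible set $S$ (as above) that describe the minimizer. -/

import Mathlib

namespace ExtendedUFM

noncomputable section

/-- The weights of an `L`-layer linear network with layer dimensions `d 0, …, d L`.  The layer
usually called `W_{j+1}`, of size `d (j+1) × d j`, has index `j : Fin L`. -/
abbrev Layers (L : ℕ) (d : ℕ → ℕ) : Type :=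
  (j : Fin L) → Matrix (Fin (d (j + 1))) (Fin (d j)) ℝ

/-- The product `W_i ⋯ W_1` of the first `i` layers. -/
def partialProd {L : ℕ} {d : ℕ → ℕ} (W : Layers L d) :
    (i : ℕ) → i ≤ L → Matrix (Fin (d i)) (Fin (d 0)) ℝ
  | 0, _ => 1
  | i + 1, h => W ⟨i, h⟩ * partialProd W i (Nat.le_of_succ_le h)

/-- The full product `W_L ⋯ W_1`. -/
def layerProd {L : ℕ} {d : ℕ → ℕ} (W : Layers L d) : Matrix (Fin (d L)) (Fin (d 0)) ℝ :=
  partialProd W L le_rfl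

/-- The last layer `W_L` of a network with `L = m + 1` layers. -/
def lastLayer {m : ℕ} {d : ℕ → ℕ} (W : Layers (m + 1) d) :
    Matrix (Fin (d (m + 1))) (Fin (d m)) ℝ :=
  W (Fin.last m)

/-- `r = min (d_L, …, d_0)`. -/
def minWidth (L : ℕ) (d : ℕ → ℕ) : ℕ :=
  (Finset.range (L + 1)).inf' Finset.nonempty_range_add_one d

/-- Index type of the training samples: the sample `⟨k, i⟩` is the `i`-th one of class `k`. -/
abbrev Samples {K : ℕ} (n : Fin K → ℕ) : Type := (k : Fin K) × Fin (n k)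

/-- The total number `N` of samples, as a real number. -/
def total {K : ℕ} (n : Fin K → ℕ) : ℝ := ((∑ k, n k : ℕ) : ℝ)

/-- The label matrix `Y`: the column of a sample of class `k` is the one-hot vector `e_k`. -/
def labels {K : ℕ} (n : Fin K → ℕ) : Matrix (Fin K) (Samples n) ℝ :=
  Matrix.of fun l s => if l = s.1 then 1 else 0

/-- The squared Frobenius norm. -/
def frobSq {ι κ : Type*} [Fintype ι] [Fintype κ] (A : Matrix ι κ ℝ) : ℝ :=
  ∑ i, ∑ j, A i j ^ 2

/-- The regularized mean square objective
`1/(2N) ‖W_L ⋯ W_1 H + b 1ᵀ - Y‖² + 1/2 ∑ⱼ λ_{Wⱼ} ‖Wⱼ‖² + λ_H/2 ‖H‖²`.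
The number of classes is `K = d L`. -/
def objective {L : ℕ} {d : ℕ → ℕ} (n : Fin (d L) → ℕ) (lamW : Fin L → ℝ) (lamH : ℝ)
    (W : Layers L d) (H : Matrix (Fin (d 0)) (Samples n) ℝ) (b : Fin (d L) → ℝ) : ℝ :=
  1 / (2 * total n) *
      frobSq (layerProd W * H + Matrix.vecMulVec b (fun _ : Samples n => (1 : ℝ)) - labels n)
    + 1 / 2 * ∑ j, lamW j * frobSq (W j) + lamH / 2 * frobSq H

/-- `(W_L, …, W_1, H, b)` is a global minimizer of the objective. -/
def IsGlobalMinimizer {L : ℕ} {d : ℕ → ℕ} (n : Fin (d L) → ℕ) (lamW : Fin L → ℝ) (lamH : ℝ)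
    (W : Layers L d) (H : Matrix (Fin (d 0)) (Samples n) ℝ) (b : Fin (d L) → ℝ) : Prop :=
  ∀ (W' : Layers L d) (H' : Matrix (Fin (d 0)) (Samples n) ℝ) (b' : Fin (d L) → ℝ),
    objective n lamW lamH W H b ≤ objective n lamW lamH W' H' b'

/-- The matrix `H̄` of class means. -/
def classMeans {K p : ℕ} {n : Fin K → ℕ} (H : Matrix (Fin p) (Samples n) ℝ) :
    Matrix (Fin p) (Fin K) ℝ :=
  Matrix.of fun a k => (∑ i : Fin (n k), H a ⟨k, i⟩) / n k

/-- `D = diag (√n_1, …, √n_K)`. -/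
def sqrtCounts {K : ℕ} (n : Fin K → ℕ) : Matrix (Fin K) (Fin K) ℝ :=
  Matrix.diagonal fun k => √(n k : ℝ)

/-- `Ŷ = (I - (1/N) n 1ᵀ) D`. -/
def centeredLabels {K : ℕ} (n : Fin K → ℕ) : Matrix (Fin K) (Fin K) ℝ :=
  (1 - (1 / total n) • Matrix.vecMulVec (fun k => (n k : ℝ)) (fun _ => (1 : ℝ))) * sqrtCounts n

/-- `A = U diag(κ) Vᵀ` is a singular value decomposition of the square matrix `A`: `U`, `V` are
orthogonal and `κ` lists the singular values in decreasing order. -/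
structure IsSVD {K : ℕ} (A U : Matrix (Fin K) (Fin K) ℝ) (κ : Fin K → ℝ)
    (V : Matrix (Fin K) (Fin K) ℝ) : Prop where
  left_orth : U ∈ Matrix.orthogonalGroup (Fin K) ℝ
  right_orth : V ∈ Matrix.orthogonalGroup (Fin K) ℝ
  nonneg : ∀ k, 0 ≤ κ k
  antitone : Antitone κ
  eq : A = U * Matrix.diagonal κ * V.transpose

/-- `(N λ_{W_L} ⋯ λ_{W_1} λ_H)^{1/L}`. -/
def rootLam {L K : ℕ} (n : Fin K → ℕ) (lamW : Fin L → ℝ) (lamH : ℝ) : ℝ :=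
  (total n * (∏ j, lamW j) * lamH) ^ (1 / (L : ℝ))

/-- Left-hand side `(N λ_{W_L} ⋯ λ_{W_1} λ_H)^{1/L} L² N` of the threshold condition. -/
def threshLeft {L K : ℕ} (n : Fin K → ℕ) (lamW : Fin L → ℝ) (lamH : ℝ) : ℝ :=
  rootLam n lamW lamH * (L : ℝ) ^ 2 * total n

/-- Right-hand side `κ_k² (L-1)^{(L-1)/L}` of the threshold condition (with `0 ^ 0 = 1`). -/
def threshRight (L : ℕ) (κk : ℝ) : ℝ :=
  κk ^ 2 * ((L : ℝ) - 1) ^ (((L : ℝ) - 1) / L)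

/-- `c = λ_{W_1}^{L-1} / (λ_{W_L} ⋯ λ_{W_2})`, where `L = m + 1`. -/
def cConst {m : ℕ} (lamW : Fin (m + 1) → ℝ) : ℝ :=
  lamW 0 ^ m / ∏ j : Fin m, lamW j.succ

/-- `x` is the largest real solution of `α - x^{L-1}/(x^L+1)² = 0`. -/
def IsLargestRoot (L : ℕ) (α x : ℝ) : Prop :=
  IsGreatest {y : ℝ | y ^ L + 1 ≠ 0 ∧ α - y ^ (L - 1) / (y ^ L + 1) ^ 2 = 0} x

/-- `Υ₁ = diag (σ_1², …, σ_K²)`; here `s k` stands for `σ_k²`. -/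
def upsilonOne {K : ℕ} (s : Fin K → ℝ) : Matrix (Fin K) (Fin K) ℝ := Matrix.diagonal s

/-- `Υ₂ = diag (σ_k^{2L} / (c σ_k^{2L} + N λ_H)²)`, with `q = N λ_H`. -/
def upsilonTwo {K : ℕ} (L : ℕ) (c q : ℝ) (s : Fin K → ℝ) : Matrix (Fin K) (Fin K) ℝ :=
  Matrix.diagonal fun k => s k ^ L / (c * s k ^ L + q) ^ 2

/-- `s k = σ_k²` for a network with `L = m + 1` layers, relative to the set `S` of indices with
nonvanishing value: `σ_k² = (N λ_H / c)^{1/L} x_k*` for `k ∈ S`, with `x_k*` the largest root for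
`α = (N / κ_k²) (N λ_{W_L} ⋯ λ_{W_1} λ_H)^{1/L}`, and `σ_k² = 0` for `k ∉ S`.  The set `S` holds
every index among the first `r` with strict threshold inequality, and only indices among the first
`r` that satisfy the threshold inequality. -/
structure IsSpectrum {m : ℕ} {d : ℕ → ℕ} (n : Fin (d (m + 1)) → ℕ) (lamW : Fin (m + 1) → ℝ)
    (lamH : ℝ) (κ : Fin (d (m + 1)) → ℝ) (S : Set (Fin (d (m + 1))))
    (s : Fin (d (m + 1)) → ℝ) : Prop where
  mem_of_lt : ∀ k : Fin (d (m + 1)), (k : ℕ) < minWidth (m + 1) d →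
    threshLeft n lamW lamH < threshRight (m + 1) (κ k) → k ∈ S
  lt_width : ∀ k ∈ S, (k : ℕ) < minWidth (m + 1) d
  le_thresh : ∀ k ∈ S, threshLeft n lamW lamH ≤ threshRight (m + 1) (κ k)
  eq_root : ∀ k ∈ S, ∃ x : ℝ,
    IsLargestRoot (m + 1) (total n / κ k ^ 2 * rootLam n lamW lamH) x ∧
      s k = (total n * lamH / cConst lamW) ^ (1 / ((m + 1 : ℕ) : ℝ)) * x
  eq_zero : ∀ k ∉ S, s k = 0

/-- The indices `k ≤ r` for which the strict threshold inequality holds. -/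
def activeSet {L : ℕ} {d : ℕ → ℕ} (n : Fin (d L) → ℕ) (lamW : Fin L → ℝ) (lamH : ℝ)
    (κ : Fin (d L) → ℝ) : Set (Fin (d L)) :=
  {k | (k : ℕ) < minWidth L d ∧ threshLeft n lamW lamH < threshRight L (κ k)}

/-- The geometry of `(W_L, …, W_1, H)` relative to the decomposition `Ŷ = U diag(κ) Vᵀ`. -/
structure HasGeometry {m : ℕ} {d : ℕ → ℕ} {n : Fin (d (m + 1)) → ℕ} (lamW : Fin (m + 1) → ℝ)
    (lamH : ℝ) (W : Layers (m + 1) d) (H : Matrix (Fin (d 0)) (Samples n) ℝ)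
    (U : Matrix (Fin (d (m + 1))) (Fin (d (m + 1))) ℝ) (κ : Fin (d (m + 1)) → ℝ)
    (V : Matrix (Fin (d (m + 1))) (Fin (d (m + 1))) ℝ)
    (S : Set (Fin (d (m + 1)))) (s : Fin (d (m + 1)) → ℝ) : Prop where
  /-- `Uᵀ W_L W_Lᵀ U = (λ_{W_1} / λ_{W_L}) Υ₁` -/
  last_gram : U.transpose * (lastLayer W * (lastLayer W).transpose) * U
    = (lamW 0 / lamW (Fin.last m)) • upsilonOne s
  /-- `Uᵀ (W_L ⋯ W_1) (W_L ⋯ W_1)ᵀ U = c Υ₁^L` -/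
  prod_gram : U.transpose * (layerProd W * (layerProd W).transpose) * U
    = cConst lamW • upsilonOne s ^ (m + 1)
  /-- `Vᵀ D H̄ᵀ H̄ D V = c Υ₂ κ²` -/
  feature_gram :
    (classMeans H * sqrtCounts n * V).transpose * (classMeans H * sqrtCounts n * V)
      = cConst lamW •
          (upsilonTwo (m + 1) (cConst lamW) (total n * lamH) s * Matrix.diagonal κ ^ 2)
  /-- `Uᵀ W_L ⋯ W_1 H̄ D V = c Υ₂ (c Υ₁^L + N λ_H I) κ` -/
  cross : U.transpose * layerProd W * (classMeans H * sqrtCounts n * V)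
    = cConst lamW •
        (upsilonTwo (m + 1) (cConst lamW) (total n * lamH) s
          * (cConst lamW • upsilonOne s ^ (m + 1) + (total n * lamH) • 1) * Matrix.diagonal κ)
  /-- For `k ∈ S`, the `k`-th row `w` of `Uᵀ W_L ⋯ W_1` and the `k`-th column `g` of `H̄ D V` are
  nonzero, with the same Euclidean direction. -/
  aligned : ∀ k ∈ S, ∀ w g : EuclideanSpace ℝ (Fin (d 0)),
    w = WithLp.toLp 2 (fun a => (U.transpose * layerProd W) k a) →
    g = WithLp.toLp 2 (fun a => (classMeans H * sqrtCounts n * V) a k) →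
      w ≠ 0 ∧ g ≠ 0 ∧ ‖w‖⁻¹ • w = ‖g‖⁻¹ • g
  /-- For `k ∉ S` both vanish. -/
  vanish : ∀ k ∉ S, ∀ a, (U.transpose * layerProd W) k a = 0 ∧
    (classMeans H * sqrtCounts n * V) a k = 0

end

end ExtendedUFM

/-! The bias and the variation within classes are eliminated first. Stationarity in `b` makes the
residual rows sum to zero; with the normal equation for `H` this forces equal features inside each
class, samples summing to zero, and `b = n / N`. Hence `W` and `G = H̄ D` minimize `coreObjective`
with target `Ŷ` (`core_min`).

Perturbations then make the minimizer rigid. Write `P = W_L ⋯ W_1`. The normal equation gives `G =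
Pᵀ X` with `(P Pᵀ + N λ_H) X = Ŷ`. Rotating the last layer infinitesimally shows that `P G Ŷᵀ` is
symmetric, whence `P Pᵀ` commutes with `Ŷ Ŷᵀ`. Moving a factor `1 + t E` between adjacent layers
shows that they are balanced, so `P Pᵀ` is a multiple of `(W_L W_Lᵀ)^L` and the commutation passes
to the `L`-th root. A common eigenbasis of `W_L W_Lᵀ` and `Ŷ Ŷᵀ` is completed to a singular value
decomposition of `Ŷ`.

In these frames the problem decouples: the objective is half the sum of the costs `L Λ x + (κ² / N)
/ (x^L + 1)` (`modeCost`), with at most `r` nonzero `x_k` because `P` has rank at most `r`, and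
diagonal layers attain every such spectrum (`exists_spectralForm`). Weighted AM-GM (`young_theta`)
shows that a nonzero mode can compete with `x = 0` only from the threshold on. Comparison with `0`
also puts the minimizing `x` on the branch `x^L ≥ L - 1`, which makes it the largest root of the
stationarity equation (`largestRoot_of_minimizer`). Exchanging two modes shows that larger singular
values are activated first; ties are settled by the order of the eigenbasis.

For an arbitrary decomposition, (i) pins the support to the active set and (ii) keeps that set from
splitting a repeated singular value. Then `x_k` depends on `κ_k` alone, and the diagonal form
transfers to every left singular frame (`IsSVD.diagonal_of_diagonal`). -/

namespace ExtendedUFM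

open Matrix

/-! ### Frobenius norm and orthogonal invariance -/

section Frobenius

variable {ι κ μ : Type*} [Fintype ι] [Fintype κ] [Fintype μ]

theorem frobSq_eq_trace (A : Matrix ι κ ℝ) : frobSq A = trace (A * Aᵀ) := by
  simp [frobSq, trace, mul_apply, sq]

theorem frobSq_eq_zero {A : Matrix ι κ ℝ} (h : frobSq A = 0) : A = 0 := by
  ext i j
  have h1 := (Finset.sum_eq_zero_iff_of_nonneg
    (fun i _ => Finset.sum_nonneg fun j _ => sq_nonneg (A i j))).1 h i (Finset.mem_univ i)
  have h2 := (Finset.sum_eq_zero_iff_of_nonneg (fun j _ => sq_nonneg (A i j))).1 h1 j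
    (Finset.mem_univ j)
  simpa using h2

theorem frobSq_add_smul (A B : Matrix ι κ ℝ) (t : ℝ) :
    frobSq (A + t • B) = frobSq A + 2 * t * trace (A * Bᵀ) + t ^ 2 * frobSq B := by
  simp only [frobSq, trace, mul_apply, diag_apply, transpose_apply, Matrix.add_apply, Matrix.smul_apply,
    smul_eq_mul, Finset.mul_sum, ← Finset.sum_add_distrib]
  refine Finset.sum_congr rfl fun i _ => Finset.sum_congr rfl fun j _ => ?_
  ring

theorem frobSq_transpose (A : Matrix ι κ ℝ) : frobSq Aᵀ = frobSq A := by
  rw [frobSq, frobSq, Finset.sum_comm]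
  rfl

theorem frobSq_mul_left [DecidableEq ι] {U : Matrix ι ι ℝ} (hU : U ∈ orthogonalGroup ι ℝ)
    (A : Matrix ι κ ℝ) : frobSq (U * A) = frobSq A := by
  have h : Uᵀ * U = 1 := (mem_orthogonalGroup_iff' ι ℝ).1 hU
  rw [← frobSq_transpose, frobSq_eq_trace, ← frobSq_transpose A, frobSq_eq_trace]
  congr 1
  simp only [transpose_mul, transpose_transpose]
  rw [Matrix.mul_assoc, ← Matrix.mul_assoc Uᵀ, h, Matrix.one_mul]

theorem transpose_mem_orthogonal [DecidableEq ι] {U : Matrix ι ι ℝ}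
    (hU : U ∈ orthogonalGroup ι ℝ) : Uᵀ ∈ orthogonalGroup ι ℝ := by
  rw [mem_orthogonalGroup_iff]
  simpa using (mem_orthogonalGroup_iff' ι ℝ).1 hU

theorem frobSq_mul_right [DecidableEq κ] {V : Matrix κ κ ℝ} (hV : V ∈ orthogonalGroup κ ℝ)
    (A : Matrix ι κ ℝ) : frobSq (A * V) = frobSq A := by
  rw [← frobSq_transpose, transpose_mul, frobSq_mul_left (transpose_mem_orthogonal hV),
    frobSq_transpose]

end Frobenius

/-- First-order condition along a curve. All perturbations used below have cost polynomial in `t`;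
the term `t ^ 4` is for curves that move the layer product at order `t ^ 2`. -/
theorem linear_coeff_eq_zero {b c e : ℝ} (h : ∀ t : ℝ, 0 ≤ b * t + c * t ^ 2 + e * t ^ 4) :
    b = 0 := by
  have hmin : IsLocalMin (fun t : ℝ => b * t + c * t ^ 2 + e * t ^ 4) 0 :=
    Filter.Eventually.of_forall fun t => by simpa using h t
  have hd : HasDerivAt (fun t : ℝ => b * t + c * t ^ 2 + e * t ^ 4)
      (b * 1 + c * (2 * 0 ^ 1 * 1) + e * (4 * 0 ^ 3 * 1)) 0 := by
    refine HasDerivAt.add (HasDerivAt.add ?_ ?_) ?_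
    · exact (hasDerivAt_id (0 : ℝ)).const_mul b
    · exact ((hasDerivAt_id (0 : ℝ)).pow 2).const_mul c
    · exact ((hasDerivAt_id (0 : ℝ)).pow 4).const_mul e
  simpa using hmin.hasDerivAt_eq_zero hd

/-! ### Products of layers -/

section Products

variable {L : ℕ} {d : ℕ → ℕ}

theorem partialProd_succ (W : Layers L d) (i : ℕ) (h : i + 1 ≤ L) :
    partialProd W (i + 1) h = W ⟨i, h⟩ * partialProd W i (Nat.le_of_succ_le h) := rfl

theorem partialProd_congr {W W' : Layers L d} (i : ℕ) (h : i ≤ L)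
    (hW : ∀ k : Fin L, (k : ℕ) < i → W k = W' k) : partialProd W i h = partialProd W' i h := by
  induction i with
  | zero => rfl
  | succ i ih =>
    rw [partialProd_succ, partialProd_succ, hW ⟨i, h⟩ (Nat.lt_succ_self i),
      ih _ fun k hk => hW k (Nat.lt_succ_of_lt hk)]

/-- The upper layers of a network act by left multiplication with a fixed matrix. -/
theorem exists_suffix (W : Layers L d) (j : ℕ) (hj : j ≤ L) :
    ∀ i, j ≤ i → ∀ h : i ≤ L, ∃ S : Matrix (Fin (d i)) (Fin (d j)) ℝ, ∀ W' : Layers L d,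
      (∀ k : Fin L, j ≤ (k : ℕ) → W' k = W k) →
        partialProd W' i h = S * partialProd W' j hj := by
  intro i hji
  induction i, hji using Nat.le_induction with
  | base => exact fun _ => ⟨1, fun W' _ => (Matrix.one_mul _).symm⟩
  | succ i hji ih =>
    intro h
    obtain ⟨S, hS⟩ := ih (Nat.le_of_succ_le h)
    refine ⟨W ⟨i, h⟩ * S, fun W' hW' => ?_⟩
    rw [partialProd_succ, hW' _ (by simpa using hji), hS W' hW', Matrix.mul_assoc]

end Products

/-- The regularized least squares objective without bias, with target `A`. -/
noncomputable def coreObjective {L : ℕ} {d : ℕ → ℕ} {ι : Type*} [Fintype ι] (N : ℝ)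
    (lamW : Fin L → ℝ) (lamH : ℝ) (A : Matrix (Fin (d L)) ι ℝ) (W : Layers L d)
    (G : Matrix (Fin (d 0)) ι ℝ) : ℝ :=
  1 / (2 * N) * frobSq (layerProd W * G - A)
    + 1 / 2 * ∑ j, lamW j * frobSq (W j) + lamH / 2 * frobSq G

/-- The normal equation of the features. -/
theorem normal_eq_of_min {L : ℕ} {d : ℕ → ℕ} {ι : Type*} [Fintype ι] {N : ℝ} (hN : 0 < N)
    {lamW : Fin L → ℝ} {lamH : ℝ} {A : Matrix (Fin (d L)) ι ℝ} {W : Layers L d}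
    {G : Matrix (Fin (d 0)) ι ℝ}
    (h : ∀ G', coreObjective N lamW lamH A W G ≤ coreObjective N lamW lamH A W G') :
    (layerProd W)ᵀ * (layerProd W * G - A) + (N * lamH) • G = 0 := by
  set P := layerProd W with hP
  set E := Pᵀ * (P * G - A) + (N * lamH) • G with hE
  apply frobSq_eq_zero
  -- `E` is `N` times the gradient in `G`, so the derivative along `E` itself is `‖E‖² / N`.
  have key : 1 / N * trace ((P * G - A) * (P * E)ᵀ) + lamH * trace (G * Eᵀ) = 0 := by
    refine linear_coeff_eq_zero (c := 1 / (2 * N) * frobSq (P * E) + lamH / 2 * frobSq E)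
      (e := 0) fun t => ?_
    have h1 := h (G + t • E)
    have h2 : P * (G + t • E) - A = (P * G - A) + t • (P * E) := by
      rw [Matrix.mul_add, Matrix.mul_smul]; abel
    simp only [coreObjective, ← hP, h2, frobSq_add_smul] at h1
    have h3 : 1 / (2 * N) * (2 * t * trace ((P * G - A) * (P * E)ᵀ))
        = 1 / N * trace ((P * G - A) * (P * E)ᵀ) * t := by
      field_simp
    nlinarith [h1, h3]
  have h4 : trace ((P * G - A) * (P * E)ᵀ) = trace (Pᵀ * (P * G - A) * Eᵀ) := by
    rw [transpose_mul, ← Matrix.mul_assoc, trace_mul_comm, Matrix.mul_assoc]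
  have h5 : frobSq E = N * (1 / N * trace ((P * G - A) * (P * E)ᵀ) + lamH * trace (G * Eᵀ)) := by
    rw [frobSq_eq_trace, h4]
    nth_rewrite 1 [hE]
    rw [Matrix.add_mul, trace_add, Matrix.smul_mul, trace_smul, smul_eq_mul]
    field_simp
  rw [h5, key, mul_zero]

/-! ### First-order conditions for the layers -/

section Critical

variable {m : ℕ} {d : ℕ → ℕ} {ι : Type*} [Fintype ι] {N lamH : ℝ}
  {lamW : Fin (m + 1) → ℝ} {A : Matrix (Fin (d (m + 1))) ι ℝ}
  {W : Layers (m + 1) d} {G : Matrix (Fin (d 0)) ι ℝ}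

theorem layerProd_update_last (X : Matrix (Fin (d (m + 1))) (Fin (d m)) ℝ) :
    layerProd (Function.update W (Fin.last m) X)
      = X * partialProd W m (Nat.le_succ m) := by
  have h := partialProd_succ (Function.update W (Fin.last m) X) m le_rfl
  rw [layerProd, h]
  congr 1
  · exact Function.update_self (Fin.last m) X W
  · refine partialProd_congr m _ fun k hk => Function.update_of_ne ?_ _ _
    rintro rfl
    simp at hk

theorem layerProd_eq_last_mul (W : Layers (m + 1) d) :
    layerProd W = lastLayer W * partialProd W m (Nat.le_succ m) := rfl

theorem sum_update_last (X : Matrix (Fin (d (m + 1))) (Fin (d m)) ℝ) :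
    ∑ j, lamW j * frobSq (Function.update W (Fin.last m) X j)
      = ∑ j, lamW j * frobSq (W j)
        + lamW (Fin.last m) * (frobSq X - frobSq (lastLayer W)) := by
  rw [Fin.sum_univ_castSucc, Fin.sum_univ_castSucc]
  have h1 : ∀ j : Fin m, Function.update W (Fin.last m) X j.castSucc = W j.castSucc :=
    fun j => Function.update_of_ne (Fin.castSucc_lt_last j).ne _ _
  have h2 : frobSq (Function.update W (Fin.last m) X (Fin.last m)) = frobSq X := by
    rw [Function.update_self]
  simp only [h1]
  rw [h2, lastLayer]
  ring

theorem trace_mul_skew {n : Type*} [Fintype n] {B S : Matrix n n ℝ} (hB : Bᵀ = B)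
    (hS : Sᵀ = -S) : trace (B * S) = 0 := by
  have h : trace (B * S) = - trace (B * S) := by
    calc trace (B * S) = trace (B * S)ᵀ := (trace_transpose _).symm
      _ = trace (-(S * B)) := by rw [transpose_mul, hB, hS, Matrix.neg_mul]
      _ = - trace (B * S) := by rw [trace_neg, trace_mul_comm]
  linarith

/-- At a minimizer, the product `W_L ⋯ W_1 G Aᵀ` is symmetric. -/
theorem prod_symm_of_min (hN : 0 < N)
    (h : ∀ W', coreObjective N lamW lamH A W G ≤ coreObjective N lamW lamH A W' G) :
    (layerProd W * G * Aᵀ)ᵀ = layerProd W * G * Aᵀ := by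
  set P := layerProd W with hP
  set Q := lastLayer W with hQ
  set M := P * G * Aᵀ with hM
  -- `S` is skew, so `(1 + t S) Q` has the norm of `Q` up to order `t ^ 2`, and only the data term
  -- has a derivative. Its vanishing becomes `trace (Mᵀ S) = 0`, which says `‖S‖² = 0`.
  set S := Mᵀ - M with hS
  have hSt : Sᵀ = -S := by rw [hS, transpose_sub, transpose_transpose]; abel
  have key : 1 / N * trace ((P * G - A) * (S * P * G)ᵀ) = 0 := by
    refine linear_coeff_eq_zero
      (c := 1 / (2 * N) * frobSq (S * P * G) + 1 / 2 * (lamW (Fin.last m) * frobSq (S * Q)))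
      (e := 0) fun t => ?_
    have h1 := h (Function.update W (Fin.last m) (Q + t • (S * Q)))
    have h2 : layerProd (Function.update W (Fin.last m) (Q + t • (S * Q))) * G - A
        = (P * G - A) + t • (S * P * G) := by
      rw [layerProd_update_last, Matrix.add_mul, Matrix.smul_mul, Matrix.mul_assoc S Q,
        ← layerProd_eq_last_mul, ← hP, Matrix.add_mul, Matrix.smul_mul]
      abel
    have h3 : trace (Q * (S * Q)ᵀ) = 0 := by
      rw [transpose_mul, ← Matrix.mul_assoc, hSt, Matrix.mul_neg, trace_neg,
        trace_mul_skew (by simp) hSt, neg_zero]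
    have h4 : 1 / (2 * N) * (2 * t * trace ((P * G - A) * (S * P * G)ᵀ))
        = 1 / N * trace ((P * G - A) * (S * P * G)ᵀ) * t := by
      field_simp
    simp only [coreObjective, h2, sum_update_last, ← hQ, ← hP, frobSq_add_smul, h3] at h1
    nlinarith [h1, h4]
  have k1 : trace ((P * G - A) * (S * P * G)ᵀ) = 0 := by
    rcases mul_eq_zero.1 key with h | h
    · exact absurd h (by positivity)
    · exact h
  have k2 : trace (P * G * (S * P * G)ᵀ) = 0 := by
    rw [Matrix.mul_assoc S, transpose_mul, ← Matrix.mul_assoc, hSt, Matrix.mul_neg, trace_neg,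
      trace_mul_skew (by simp) hSt, neg_zero]
  have k3 : trace (Mᵀ * S) = 0 := by
    rw [Matrix.sub_mul, trace_sub, k2, zero_sub, neg_eq_zero] at k1
    have : A * (S * P * G)ᵀ = -(Mᵀ * S) := by
      rw [Matrix.mul_assoc S, transpose_mul, hSt, ← Matrix.mul_assoc, Matrix.mul_neg, hM,
        transpose_mul (P * G), transpose_transpose]
    rw [this, trace_neg, neg_eq_zero] at k1
    exact k1
  have k4 : trace (M * S) = 0 := by
    have : trace (M * S) = - trace (Mᵀ * S) := by
      rw [← trace_transpose, transpose_mul, hSt, Matrix.neg_mul, trace_neg, trace_mul_comm]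
    rw [this, k3, neg_zero]
  have k5 : frobSq S = 0 := by
    rw [frobSq_eq_trace, hSt, Matrix.mul_neg, trace_neg]
    nth_rewrite 1 [hS]
    rw [Matrix.sub_mul, trace_sub, k3, k4]
    simp
  have := frobSq_eq_zero k5
  exact sub_eq_zero.1 this

/-- Adjacent layers of a minimizer are balanced. -/
theorem balanced_of_min (hN : 0 < N)
    (h : ∀ W', coreObjective N lamW lamH A W G ≤ coreObjective N lamW lamH A W' G)
    (j : ℕ) (hj : j + 1 < m + 1) :
    lamW ⟨j + 1, hj⟩ • ((W ⟨j + 1, hj⟩)ᵀ * W ⟨j + 1, hj⟩)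
      = lamW ⟨j, Nat.lt_of_succ_lt hj⟩ •
        (W ⟨j, Nat.lt_of_succ_lt hj⟩ * (W ⟨j, Nat.lt_of_succ_lt hj⟩)ᵀ) := by
  set a : Fin (m + 1) := ⟨j, Nat.lt_of_succ_lt hj⟩ with ha
  set b : Fin (m + 1) := ⟨j + 1, hj⟩ with hb
  have hab : a ≠ b := by simp [ha, hb]
  let X : Matrix (Fin (d (j + 1 + 1))) (Fin (d (j + 1))) ℝ := W b
  let Y : Matrix (Fin (d (j + 1))) (Fin (d j)) ℝ := W a
  let E : Matrix (Fin (d (j + 1))) (Fin (d (j + 1))) ℝ :=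
    lamW b • (Xᵀ * X) - lamW a • (Y * Yᵀ)
  have hE : E = lamW b • (Xᵀ * X) - lamW a • (Y * Yᵀ) := rfl
  have hEt : Eᵀ = E := by simp [hE]
  -- The factors `1 + t E` and `1 - t E` cancel to first order in the product, so only the
  -- regularizer has a derivative at `t = 0`. By the choice of `E` that derivative is `‖E‖²`.
  let W' : ℝ → Layers (m + 1) d := fun t =>
    Function.update (Function.update W a (Y + t • -(E * Y))) b (X + t • (X * E))
  have hWa : ∀ t, W' t a = Y + t • -(E * Y) := fun t => by
    simp only [W']; rw [Function.update_of_ne hab, Function.update_self]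
  have hWb : ∀ t, W' t b = X + t • (X * E) := fun t => by
    simp only [W']; rw [Function.update_self]
  have hWo : ∀ t k, k ≠ a → k ≠ b → W' t k = W k := fun t k h1 h2 => by
    simp only [W']; rw [Function.update_of_ne h2, Function.update_of_ne h1]
  obtain ⟨S, hS⟩ := exists_suffix W (j + 1 + 1) hj (m + 1) hj le_rfl
  let R := partialProd W j (by omega)
  have hprod : ∀ t, layerProd (W' t) = layerProd W + t ^ 2 • -(S * (X * E * (E * Y)) * R) := by
    intro t
    have e1 : layerProd (W' t) = S * partialProd (W' t) (j + 1 + 1) hj := by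
      refine hS (W' t) fun k hk => hWo t k ?_ ?_
      · rintro rfl; simp only [ha] at hk; omega
      · rintro rfl; simp only [hb] at hk; omega
    have e2 : layerProd W = S * partialProd W (j + 1 + 1) hj := hS W fun _ _ => rfl
    have e3 : partialProd (W' t) j (by omega) = R := by
      refine partialProd_congr j _ fun k hk => hWo t k ?_ ?_
      · rintro rfl; simp only [ha] at hk; omega
      · rintro rfl; simp only [hb] at hk; omega
    have e4 : partialProd (W' t) (j + 1 + 1) hj = (X + t • (X * E)) * ((Y + t • -(E * Y)) * R) := by
      rw [partialProd_succ, partialProd_succ, e3]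
      exact congrArg₂ (· * ·) (hWb t) (congrArg (· * R) (hWa t))
    have e5 : partialProd W (j + 1 + 1) hj = X * (Y * R) := rfl
    rw [e1, e2, e4, e5]
    simp only [Matrix.add_mul, Matrix.mul_add, Matrix.smul_mul, Matrix.mul_smul, Matrix.neg_mul,
      Matrix.mul_neg, Matrix.mul_assoc, smul_neg, smul_add, smul_smul, sq]
    abel
  have hsum : ∀ t, ∑ k, lamW k * frobSq (W' t k) = ∑ k, lamW k * frobSq (W k)
      + (lamW a * (frobSq (Y + t • -(E * Y)) - frobSq Y)
        + lamW b * (frobSq (X + t • (X * E)) - frobSq X)) := by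
    intro t
    rw [← sub_eq_iff_eq_add', ← Finset.sum_sub_distrib, Fintype.sum_eq_add a b hab]
    · rw [hWa, hWb]; simp only [X, Y]; ring
    · rintro k ⟨h1, h2⟩
      rw [hWo t k h1 h2, sub_self]
  have key : lamW b * trace (X * (X * E)ᵀ) - lamW a * trace (Y * (E * Y)ᵀ) = 0 := by
    let Z := -(S * (X * E * (E * Y)) * R) * G
    refine linear_coeff_eq_zero
      (c := 1 / N * trace ((layerProd W * G - A) * Zᵀ)
        + 1 / 2 * (lamW a * frobSq (-(E * Y)) + lamW b * frobSq (X * E)))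
      (e := 1 / (2 * N) * frobSq Z) fun t => ?_
    have h1 := h (W' t)
    have h2 : layerProd (W' t) * G - A = (layerProd W * G - A) + t ^ 2 • Z := by
      rw [hprod, Matrix.add_mul, Matrix.smul_mul]
      simp only [Z]; abel
    have h4 : 1 / (2 * N) * (2 * t ^ 2 * trace ((layerProd W * G - A) * Zᵀ))
        = 1 / N * trace ((layerProd W * G - A) * Zᵀ) * t ^ 2 := by
      field_simp
    have h5 : trace (Y * (-(E * Y))ᵀ) = - trace (Y * (E * Y)ᵀ) := by
      rw [transpose_neg, Matrix.mul_neg, trace_neg]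
    simp only [coreObjective, h2, hsum, frobSq_add_smul, h5] at h1
    nlinarith [h1, h4]
  have hE0 : frobSq E = lamW b * trace (X * (X * E)ᵀ) - lamW a * trace (Y * (E * Y)ᵀ) := by
    rw [frobSq_eq_trace, hEt]
    nth_rewrite 1 [hE]
    rw [Matrix.sub_mul, trace_sub, Matrix.smul_mul, Matrix.smul_mul, trace_smul, trace_smul,
      transpose_mul, transpose_mul, hEt, trace_mul_comm X, ← Matrix.mul_assoc Y, Matrix.mul_assoc E,
      trace_mul_comm E, smul_eq_mul, smul_eq_mul]
  have := frobSq_eq_zero (hE0.trans key)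
  exact sub_eq_zero.1 this

end Critical

/-! ### Elimination of the bias and collapse within classes -/

section Reduction

variable {L : ℕ} {d : ℕ → ℕ} {n : Fin (d L) → ℕ} {lamW : Fin L → ℝ} {lamH : ℝ}

theorem total_pos {K : ℕ} {n : Fin K → ℕ} (hn : ∀ k, 0 < n k) (k : Fin K) : 0 < total n := by
  rw [total, Nat.cast_pos]
  exact Finset.sum_pos (fun k _ => hn k) ⟨k, Finset.mem_univ k⟩

theorem sum_samples {K : ℕ} {n : Fin K → ℕ} (f : Samples n → ℝ) :
    ∑ s, f s = ∑ k, ∑ i : Fin (n k), f ⟨k, i⟩ := Fintype.sum_sigma f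

theorem objective_eq_core (W : Layers L d) (H : Matrix (Fin (d 0)) (Samples n) ℝ)
    (b : Fin (d L) → ℝ) :
    objective n lamW lamH W H b = coreObjective (total n) lamW lamH
      (labels n - vecMulVec b (fun _ : Samples n => (1 : ℝ))) W H := by
  rw [objective, coreObjective]
  congr 4
  abel

/-- Features that depend only on the class, with scaled class means `G`. -/
noncomputable def spread {p K : ℕ} (n : Fin K → ℕ) (G : Matrix (Fin p) (Fin K) ℝ) :
    Matrix (Fin p) (Samples n) ℝ :=
  Matrix.of fun a s => G a s.1 / √(n s.1 : ℝ)

theorem centeredLabels_apply {K : ℕ} (n : Fin K → ℕ) (l k : Fin K) :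
    centeredLabels n l k = ((if l = k then 1 else 0) - n l / total n) * √(n k : ℝ) := by
  simp [centeredLabels, sqrtCounts, Matrix.mul_diagonal, Matrix.one_apply, vecMulVec_apply,
    div_eq_inv_mul]

theorem sum_spread_sq {K : ℕ} {n : Fin K → ℕ} (hn : ∀ k, 0 < n k) (k : Fin K) (x : ℝ) :
    ∑ _i : Fin (n k), (x / √(n k : ℝ)) ^ 2 = x ^ 2 := by
  have h : (0 : ℝ) < n k := by exact_mod_cast hn k
  rw [Finset.sum_const, Finset.card_univ, Fintype.card_fin, nsmul_eq_mul, div_pow,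
    Real.sq_sqrt h.le]
  field_simp

theorem frobSq_spread {p K : ℕ} {n : Fin K → ℕ} (hn : ∀ k, 0 < n k)
    (G : Matrix (Fin p) (Fin K) ℝ) : frobSq (spread n G) = frobSq G := by
  simp only [frobSq, sum_samples]
  exact Finset.sum_congr rfl fun a _ => Finset.sum_congr rfl fun k _ =>
    sum_spread_sq hn k (G a k)

theorem mul_spread {p q K : ℕ} {n : Fin K → ℕ} (P : Matrix (Fin q) (Fin p) ℝ)
    (G : Matrix (Fin p) (Fin K) ℝ) : P * spread n G = spread n (P * G) := by
  ext a s
  simp only [mul_apply, spread, of_apply, Finset.sum_div, mul_div_assoc]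

/-- Subtracting the bias `n / N` from a label `e_k` leaves the `k`-th column of `centeredLabels n`
divided by `√n_k`. So the residual is the `spread` of the reduced residual, and `spread` preserves
the Frobenius norm. -/
theorem objective_spread (hn : ∀ k, 0 < n k) (W : Layers L d)
    (G : Matrix (Fin (d 0)) (Fin (d L)) ℝ) :
    objective n lamW lamH W (spread n G) (fun l => n l / total n)
      = coreObjective (total n) lamW lamH (centeredLabels n) W G := by
  have h : layerProd W * spread n G + vecMulVec (fun l => (n l : ℝ) / total n)
      (fun _ : Samples n => (1 : ℝ)) - labels n
      = spread n (layerProd W * G - centeredLabels n) := by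
    rw [mul_spread]
    ext l s
    have hs : √(n s.1 : ℝ) ≠ 0 := by
      have : (0 : ℝ) < n s.1 := by exact_mod_cast hn s.1
      positivity
    simp only [spread, labels, Matrix.sub_apply, Matrix.add_apply, of_apply, vecMulVec_apply,
      centeredLabels_apply]
    field_simp
    ring
  rw [objective, coreObjective, h, frobSq_spread hn, frobSq_spread hn]

variable {W : Layers L d} {H : Matrix (Fin (d 0)) (Samples n) ℝ} {b : Fin (d L) → ℝ}

/-- The residual `W_L ⋯ W_1 H + b 1ᵀ - Y`. -/
noncomputable def residual (n : Fin (d L) → ℕ) (W : Layers L d)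
    (H : Matrix (Fin (d 0)) (Samples n) ℝ) (b : Fin (d L) → ℝ) :
    Matrix (Fin (d L)) (Samples n) ℝ :=
  layerProd W * H + vecMulVec b (fun _ : Samples n => (1 : ℝ)) - labels n

/-- The residual of a minimizer has vanishing row sums. -/
theorem residual_sum_eq_zero (hN : 0 < total n) (hmin : IsGlobalMinimizer n lamW lamH W H b)
    (l : Fin (d L)) :
    ∑ s, residual n W H b l s = 0 := by
  set R := residual n W H b with hR
  let v : Fin (d L) → ℝ := fun l => ∑ s, R l s
  -- The bias moves along its own gradient, up to the factor `N`: the vector of row sums.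
  let B : Matrix (Fin (d L)) (Samples n) ℝ := vecMulVec v (fun _ => 1)
  have key : 1 / total n * trace (R * Bᵀ) = 0 := by
    refine linear_coeff_eq_zero (c := 1 / (2 * total n) * frobSq B) (e := 0) fun t => ?_
    have h1 := hmin W H (b + t • v)
    have h2 : layerProd W * H + vecMulVec (b + t • v) (fun _ : Samples n => (1 : ℝ)) - labels n
        = R + t • B := by
      rw [add_vecMulVec, smul_vecMulVec, hR, residual]
      simp only [B]
      abel
    have h4 : 1 / (2 * total n) * (2 * t * trace (R * Bᵀ)) = 1 / total n * trace (R * Bᵀ) * t := by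
      field_simp
    have h3 : layerProd W * H + vecMulVec b (fun _ : Samples n => (1 : ℝ)) - labels n = R := rfl
    simp only [objective, h2, h3, frobSq_add_smul] at h1
    nlinarith [h1, h4]
  have h5 : trace (R * Bᵀ) = ∑ l, v l ^ 2 := by
    simp only [trace, diag_apply, mul_apply, transpose_apply, B, vecMulVec_apply, mul_one, sq]
    exact Finset.sum_congr rfl fun l _ => by rw [← Finset.sum_mul]
  have h6 : ∑ l, v l ^ 2 = 0 := by
    rcases mul_eq_zero.1 key with h | h
    · exact absurd h (by positivity)
    · rw [← h5, h]
  have h7 := (Finset.sum_eq_zero_iff_of_nonneg (fun l _ => sq_nonneg (v l))).1 h6 l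
    (Finset.mem_univ l)
  simpa using h7

theorem normal_eq_features (hN : 0 < total n) (hmin : IsGlobalMinimizer n lamW lamH W H b) :
    (layerProd W)ᵀ * residual n W H b
      + (total n * lamH) • H = 0 := by
  have h := normal_eq_of_min (A := labels n - vecMulVec b (fun _ : Samples n => (1 : ℝ)))
    (lamW := lamW) (lamH := lamH) (W := W) (G := H) hN fun G' => by
      rw [← objective_eq_core, ← objective_eq_core]
      exact hmin W G' b
  rw [← h, residual]
  congr 2
  abel

theorem eq_zero_of_gram_add_smul {p q : ℕ} (P : Matrix (Fin q) (Fin p) ℝ) {ν : ℝ} (hν : 0 < ν)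
    (x : Fin p → ℝ) (h : Pᵀ *ᵥ (P *ᵥ x) + ν • x = 0) : x = 0 := by
  have h1 : (P *ᵥ x) ⬝ᵥ (P *ᵥ x) + ν * (x ⬝ᵥ x) = 0 := by
    have := congrArg (fun y => x ⬝ᵥ y) h
    simp only [dotProduct_add, dotProduct_smul, dotProduct_zero, smul_eq_mul] at this
    rwa [dotProduct_mulVec, vecMul_transpose] at this
  have h2 : 0 ≤ (P *ᵥ x) ⬝ᵥ (P *ᵥ x) := Finset.sum_nonneg fun i _ => mul_self_nonneg _
  have h3 : 0 ≤ x ⬝ᵥ x := Finset.sum_nonneg fun i _ => mul_self_nonneg _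
  have h4 : x ⬝ᵥ x = 0 := by nlinarith
  exact dotProduct_self_eq_zero.1 h4

/-- Two samples of one class have the same label and bias, so subtracting their normal equations
leaves `(Pᵀ P + N λ_H) x = 0` for the difference `x` of the features. The regularization makes this
matrix invertible. -/
theorem features_collapse (hn : ∀ k, 0 < n k) (hH : 0 < lamH)
    (hmin : IsGlobalMinimizer n lamW lamH W H b) (k : Fin (d L)) (i j : Fin (n k))
    (a : Fin (d 0)) : H a ⟨k, i⟩ = H a ⟨k, j⟩ := by
  have hN := total_pos hn k
  have h := normal_eq_features hN hmin
  set P := layerProd W with hP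
  have hx := eq_zero_of_gram_add_smul P (mul_pos hN hH) (fun a => H a ⟨k, i⟩ - H a ⟨k, j⟩) (by
    ext a
    have h1 := congrFun (congrFun h a) ⟨k, i⟩
    have h2 := congrFun (congrFun h a) ⟨k, j⟩
    have h3 : ∀ l, residual n W H b l ⟨k, i⟩
        = residual n W H b l ⟨k, j⟩
          + (P *ᵥ fun a => H a ⟨k, i⟩ - H a ⟨k, j⟩) l := by
      intro l
      simp only [residual, ← hP, Matrix.sub_apply, Matrix.add_apply, vecMulVec_apply, labels,
        of_apply, Matrix.mul_apply,
        mulVec, dotProduct, mul_sub, Finset.sum_sub_distrib]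
      ring
    simp only [Matrix.add_apply, Matrix.zero_apply, Matrix.mul_apply (M := Pᵀ), h3, Matrix.smul_apply, mul_add,
      Finset.sum_add_distrib, smul_eq_mul] at h1 h2
    simp only [Pi.add_apply, Pi.smul_apply, smul_eq_mul, Pi.zero_apply]
    rw [mulVec, dotProduct]
    linarith)
  have := congrFun hx a
  simpa [sub_eq_zero] using this

theorem sum_features_eq_zero (hN : 0 < total n) (hH : 0 < lamH)
    (hmin : IsGlobalMinimizer n lamW lamH W H b) (a : Fin (d 0)) : ∑ s, H a s = 0 := by
  have h := normal_eq_features hN hmin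
  have h1 : ∑ s, ((layerProd W)ᵀ * residual n W H b
      + (total n * lamH) • H) a s = 0 := by
    rw [h]; simp
  simp only [Matrix.add_apply, Finset.sum_add_distrib, Matrix.smul_apply, smul_eq_mul,
    ← Finset.mul_sum] at h1
  have h2 : ∑ s, ((layerProd W)ᵀ * residual n W H b) a s
      = 0 := by
    simp only [Matrix.mul_apply]
    rw [Finset.sum_comm]
    refine Finset.sum_eq_zero fun l _ => ?_
    rw [← Finset.mul_sum, residual_sum_eq_zero hN hmin, mul_zero]
  rw [h2, zero_add] at h1
  exact (mul_eq_zero.1 h1).resolve_left (mul_pos hN hH).ne'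

/-- The features sum to zero, so a vanishing row sum of the residual reduces to `N b_l = n_l`. -/
theorem bias_eq (hN : 0 < total n) (hH : 0 < lamH)
    (hmin : IsGlobalMinimizer n lamW lamH W H b) : b = fun l => n l / total n := by
  funext l
  have h := residual_sum_eq_zero hN hmin l
  simp only [residual, Matrix.sub_apply, Matrix.add_apply, Finset.sum_add_distrib, Finset.sum_sub_distrib,
    vecMulVec_apply, mul_one] at h
  have h1 : ∑ s, (layerProd W * H) l s = 0 := by
    simp only [mul_apply]
    rw [Finset.sum_comm]
    refine Finset.sum_eq_zero fun a _ => ?_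
    rw [← Finset.mul_sum, sum_features_eq_zero hN hH hmin, mul_zero]
  have h2 : ∑ _s : Samples n, b l = total n * b l := by
    rw [sum_samples, total]
    simp [Finset.sum_mul]
  have h3 : ∑ s, labels n l s = n l := by
    rw [sum_samples]
    simp [labels, apply_ite Finset.card]
  rw [h1, h2, h3] at h
  field_simp
  linarith

theorem eq_spread (hn : ∀ k, 0 < n k) (hH : 0 < lamH)
    (hmin : IsGlobalMinimizer n lamW lamH W H b) :
    H = spread n (classMeans H * sqrtCounts n) := by
  ext a ⟨k, i⟩
  have hk : (0 : ℝ) < n k := by exact_mod_cast hn k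
  have h1 : ∑ j : Fin (n k), H a ⟨k, j⟩ = n k * H a ⟨k, i⟩ := by
    rw [Finset.sum_congr rfl fun j _ => features_collapse hn hH hmin k j i a]
    simp
  simp only [spread, of_apply, sqrtCounts, mul_diagonal, classMeans, h1]
  field_simp

/-- The scaled class means of a minimizer minimize the objective without bias. -/
theorem core_min (hn : ∀ k, 0 < n k) (hN : 0 < total n) (hH : 0 < lamH)
    (hmin : IsGlobalMinimizer n lamW lamH W H b) (W' : Layers L d)
    (G' : Matrix (Fin (d 0)) (Fin (d L)) ℝ) :
    coreObjective (total n) lamW lamH (centeredLabels n) W (classMeans H * sqrtCounts n)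
      ≤ coreObjective (total n) lamW lamH (centeredLabels n) W' G' := by
  have h := hmin W' (spread n G') (fun l => n l / total n)
  rw [objective_spread hn] at h
  rw [← objective_spread hn, ← eq_spread hn hH hmin, ← bias_eq hN hH hmin]
  exact h

end Reduction

/-- A positive semidefinite matrix commutes with everything symmetric that commutes with one of
its powers. -/
theorem commute_of_commute_pow {K : ℕ} {Q B : Matrix (Fin K) (Fin K) ℝ} (hQ : Q.PosSemidef)
    {k : ℕ} (hk : k ≠ 0) (h : Commute (Q ^ k) B) : Commute Q B := by
  have hH := hQ.isHermitian
  have hnn := hQ.eigenvalues_nonneg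
  let O : Matrix (Fin K) (Fin K) ℝ := hH.eigenvectorUnitary
  have hO : O ∈ orthogonalGroup (Fin K) ℝ := hH.eigenvectorUnitary.2
  have h1 : Oᵀ * O = 1 := (mem_orthogonalGroup_iff' _ ℝ).1 hO
  have h2 : O * Oᵀ = 1 := (mem_orthogonalGroup_iff _ ℝ).1 hO
  set q := hH.eigenvalues
  have hs : Q = O * diagonal q * Oᵀ := by
    have := hH.spectral_theorem
    rw [Unitary.conjStarAlgAut_apply] at this
    simpa [O, star_eq_conjTranspose] using this
  have hpow : ∀ j : ℕ, Q ^ j = O * diagonal (q ^ j) * Oᵀ := by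
    intro j
    induction j with
    | zero => simp [h2]
    | succ j ih =>
      rw [pow_succ, ih]
      nth_rewrite 1 [hs]
      calc O * diagonal (q ^ j) * Oᵀ * (O * diagonal q * Oᵀ)
          = O * diagonal (q ^ j) * (Oᵀ * O) * diagonal q * Oᵀ := by
            simp only [Matrix.mul_assoc]
        _ = O * diagonal (q ^ (j + 1)) * Oᵀ := by
            rw [h1, Matrix.mul_one, Matrix.mul_assoc O, diagonal_mul_diagonal]
            rfl
  set B' := Oᵀ * B * O with hB'
  have hB : B = O * B' * Oᵀ := by
    calc B = (O * Oᵀ) * B * (O * Oᵀ) := by rw [h2]; simp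
      _ = O * B' * Oᵀ := by simp only [hB', Matrix.mul_assoc]
  have hconj : ∀ D : Matrix (Fin K) (Fin K) ℝ,
      O * D * Oᵀ * B = O * (D * B') * Oᵀ ∧ B * (O * D * Oᵀ) = O * (B' * D) * Oᵀ := by
    intro D
    constructor
    · rw [hB]
      calc O * D * Oᵀ * (O * B' * Oᵀ) = O * D * (Oᵀ * O) * B' * Oᵀ := by
            simp only [Matrix.mul_assoc]
        _ = _ := by rw [h1, Matrix.mul_one, Matrix.mul_assoc O D]
    · nth_rewrite 1 [hB]
      calc O * B' * Oᵀ * (O * D * Oᵀ) = O * B' * (Oᵀ * O) * D * Oᵀ := by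
            simp only [Matrix.mul_assoc]
        _ = _ := by rw [h1, Matrix.mul_one, Matrix.mul_assoc O B']
  have hcomm : diagonal (q ^ k) * B' = B' * diagonal (q ^ k) := by
    have h3 : Q ^ k * B = B * Q ^ k := h
    rw [hpow k, (hconj _).1, (hconj _).2] at h3
    have h4 := congrArg (fun M => Oᵀ * M * O) h3
    have h5 : ∀ D : Matrix (Fin K) (Fin K) ℝ, Oᵀ * (O * D * Oᵀ) * O = D := fun D => by
      calc Oᵀ * (O * D * Oᵀ) * O = (Oᵀ * O) * D * (Oᵀ * O) := by simp only [Matrix.mul_assoc]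
        _ = D := by rw [h1]; simp
    simpa only [h5] using h4
  -- A nonzero entry `B' i j` forces `q i ^ k = q j ^ k`; the eigenvalues are nonnegative, so `q i =
  -- q j`.
  have hcomm' : diagonal q * B' = B' * diagonal q := by
    ext i j
    have h3 := congrFun (congrFun hcomm i) j
    rw [diagonal_mul, mul_diagonal] at h3 ⊢
    by_cases hb : B' i j = 0
    · simp [hb]
    · have h4 : q i ^ k = q j ^ k := by
        have : (q i ^ k - q j ^ k) * B' i j = 0 := by
          simp only [Pi.pow_apply] at h3
          linear_combination h3
        exact sub_eq_zero.1 ((mul_eq_zero.1 this).resolve_right hb)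
      rw [(pow_left_inj₀ (hnn i) (hnn j) hk).1 h4, mul_comm]
  show Q * B = B * Q
  rw [hs, (hconj _).1, (hconj _).2, hcomm']

theorem mul_gram_pow_mul {p q : ℕ} (X : Matrix (Fin p) (Fin q) ℝ) (k : ℕ) :
    X * (Xᵀ * X) ^ k * Xᵀ = (X * Xᵀ) ^ (k + 1) := by
  induction k with
  | zero => simp
  | succ k ih =>
    rw [pow_succ, pow_succ (X * Xᵀ), ← ih]
    simp only [Matrix.mul_assoc]

/-! ### Consequences of balancedness -/

section Balanced

variable {m : ℕ} {d : ℕ → ℕ} {lamW : Fin (m + 1) → ℝ} {W : Layers (m + 1) d}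

/-- Adjacent layers have the same weighted Gram matrices. -/
def Balanced (lamW : Fin (m + 1) → ℝ) (W : Layers (m + 1) d) : Prop :=
  ∀ (j : ℕ) (hj : j + 1 < m + 1),
    lamW ⟨j + 1, hj⟩ • ((W ⟨j + 1, hj⟩)ᵀ * W ⟨j + 1, hj⟩)
      = lamW ⟨j, Nat.lt_of_succ_lt hj⟩ •
        (W ⟨j, Nat.lt_of_succ_lt hj⟩ * (W ⟨j, Nat.lt_of_succ_lt hj⟩)ᵀ)

/-- Inductively, the Gram matrix of the lower product is a power of the weighted `W_i W_iᵀ`. Balance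
rewrites this as a power of the weighted `W_{i+1}ᵀ W_{i+1}`, and the outer factors `W_{i+1}`,
`W_{i+1}ᵀ` raise the exponent by one. -/
theorem Balanced.partialProd_gram (hb : Balanced lamW W) (i : ℕ) (hi : i + 1 ≤ m + 1) :
    (∏ j : Fin (i + 1), lamW ⟨j, lt_of_lt_of_le j.2 hi⟩) •
        (partialProd W (i + 1) hi * (partialProd W (i + 1) hi)ᵀ)
      = (lamW ⟨i, hi⟩ • (W ⟨i, hi⟩ * (W ⟨i, hi⟩)ᵀ)) ^ (i + 1) := by
  induction i with
  | zero =>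
    have h1 : partialProd W (0 + 1) hi = W ⟨0, hi⟩ :=
      Matrix.mul_one (W ⟨0, hi⟩ : Matrix (Fin (d 1)) (Fin (d 0)) ℝ)
    rw [h1]
    simp
  | succ i ih =>
    have h1 := ih (Nat.le_of_succ_le hi)
    rw [← hb i hi] at h1
    rw [Fin.prod_univ_castSucc, partialProd_succ]
    simp only [Fin.val_castSucc, Fin.val_last]
    set X := W ⟨i + 1, hi⟩ with hX
    set R := partialProd W (i + 1) (Nat.le_of_succ_le hi) with hR
    have h2 : X * R * (X * R)ᵀ = X * (R * Rᵀ) * Xᵀ := by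
      rw [transpose_mul]; simp only [Matrix.mul_assoc]
    have h3 : ∀ c : ℝ, c • (X * (R * Rᵀ) * Xᵀ) = X * (c • (R * Rᵀ)) * Xᵀ := fun c => by
      rw [Matrix.mul_smul, Matrix.smul_mul]
    rw [h2, mul_comm, mul_smul, h3, h1, smul_pow, smul_pow, Matrix.mul_smul, Matrix.smul_mul,
      mul_gram_pow_mul, smul_smul, ← pow_succ']

theorem Balanced.prod_gram (hb : Balanced lamW W) :
    (∏ j, lamW j) • (layerProd W * (layerProd W)ᵀ)
      = (lamW (Fin.last m) • (lastLayer W * (lastLayer W)ᵀ)) ^ (m + 1) :=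
  hb.partialProd_gram m le_rfl

/-- Taking traces in the balance relations makes all weighted squared norms equal. -/
theorem Balanced.sum_frobSq (hb : Balanced lamW W) :
    ∑ j, lamW j * frobSq (W j)
      = (m + 1 : ℕ) * (lamW (Fin.last m) * trace (lastLayer W * (lastLayer W)ᵀ)) := by
  have h : ∀ i (hi : i < m + 1), lamW ⟨i, hi⟩ * frobSq (W ⟨i, hi⟩) = lamW 0 * frobSq (W 0) := by
    intro i
    induction i with
    | zero => exact fun _ => rfl
    | succ i ih =>
      intro hi
      rw [← ih (Nat.lt_of_succ_lt hi), frobSq_eq_trace, frobSq_eq_trace, trace_mul_comm,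
        ← smul_eq_mul, ← smul_eq_mul, ← trace_smul, ← trace_smul, hb i hi]
  rw [← frobSq_eq_trace]
  have h1 : lamW (Fin.last m) * frobSq (lastLayer W) = lamW 0 * frobSq (W 0) :=
    h m (Nat.lt_succ_self m)
  rw [h1, Finset.sum_congr rfl fun (j : Fin (m + 1)) _ => h j.1 j.2]
  simp

end Balanced

theorem rank_layerProd_le {L : ℕ} {d : ℕ → ℕ} (W : Layers L d) :
    (layerProd W).rank ≤ minWidth L d := by
  refine Finset.le_inf' _ _ fun i hi => ?_
  have hi' : i ≤ L := Nat.lt_succ_iff.1 (Finset.mem_range.1 hi)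
  obtain ⟨S, hS⟩ := exists_suffix W i hi' L hi' le_rfl
  rw [layerProd, hS W fun _ _ => rfl]
  exact (rank_mul_le_right _ _).trans (by simpa using rank_le_height (partialProd W i hi'))

/-! ### Commutation with the Gram matrix of the target -/

section CoreMin

variable {m : ℕ} {d : ℕ → ℕ} {N lamH : ℝ} {lamW : Fin (m + 1) → ℝ}
  {A : Matrix (Fin (d (m + 1))) (Fin (d (m + 1))) ℝ} {W : Layers (m + 1) d}
  {G : Matrix (Fin (d 0)) (Fin (d (m + 1))) ℝ}

/-- The features of a minimizer factor through the transposed product of the layers. -/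
theorem exists_feature_factor (hN : 0 < N) (hH : 0 < lamH)
    (hmin : ∀ W' G', coreObjective N lamW lamH A W G ≤ coreObjective N lamW lamH A W' G') :
    ∃ X, G = (layerProd W)ᵀ * X ∧
      layerProd W * (layerProd W)ᵀ * X + (N * lamH) • X = A := by
  have h := normal_eq_of_min hN (hmin W)
  set P := layerProd W
  have hν : N * lamH ≠ 0 := (mul_pos hN hH).ne'
  have hG : G = Pᵀ * ((N * lamH)⁻¹ • (A - P * G)) := by
    have h1 : (N * lamH) • G = Pᵀ * (A - P * G) := by
      rw [← sub_eq_zero, ← h, Matrix.mul_sub, Matrix.mul_sub]; abel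
    rw [Matrix.mul_smul, ← h1, smul_smul, inv_mul_cancel₀ hν, one_smul]
  refine ⟨(N * lamH)⁻¹ • (A - P * G), hG, ?_⟩
  rw [Matrix.mul_assoc, ← hG, smul_smul, mul_inv_cancel₀ hν, one_smul]
  abel

/-- With `T = P Pᵀ`, `M = X Xᵀ` and `ν = N λ_H`, the symmetric matrix `P G Aᵀ` is `T M T + ν T M`.
Hence `T` commutes with `M`, and so with `A Aᵀ = (T + ν) M (T + ν)`. -/
theorem commute_prod_gram (hN : 0 < N) (hH : 0 < lamH)
    (hmin : ∀ W' G', coreObjective N lamW lamH A W G ≤ coreObjective N lamW lamH A W' G') :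
    Commute (layerProd W * (layerProd W)ᵀ) (A * Aᵀ) := by
  obtain ⟨X, hG, hA⟩ := exists_feature_factor hN hH hmin
  have hsym := prod_symm_of_min hN fun W' => hmin W' G
  set P := layerProd W
  set T := P * Pᵀ with hT
  have hTt : Tᵀ = T := by simp [hT]
  set ν := N * lamH
  have hν : ν ≠ 0 := (mul_pos hN hH).ne'
  have hPG : P * G = T * X := by rw [hG, ← Matrix.mul_assoc]
  have hAt : Aᵀ = Xᵀ * T + ν • Xᵀ := by rw [← hA, transpose_add, transpose_mul, hTt, transpose_smul]
  set M := X * Xᵀ with hM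
  have hMt : Mᵀ = M := by simp [hM]
  have h1 : P * G * Aᵀ = T * M * T + ν • (T * M) := by
    rw [hPG, hAt, Matrix.mul_add, Matrix.mul_smul]
    simp only [hM, Matrix.mul_assoc]
  rw [h1, transpose_add, transpose_smul, transpose_mul (T * M), transpose_mul T, hMt, hTt,
    ← Matrix.mul_assoc] at hsym
  have h2 : M * T = T * M := by
    have := add_left_cancel hsym
    exact smul_right_injective _ hν this
  have h3 : Commute T M := h2.symm
  have h4 : A * Aᵀ = T * M * T + ν • (T * M) + ν • (M * T) + ν • ν • M := by
    rw [hAt, ← hA]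
    simp only [hM, Matrix.mul_add, Matrix.add_mul, Matrix.mul_smul, Matrix.smul_mul,
      Matrix.mul_assoc, smul_add]
    abel
  rw [h4]
  have hTT := Commute.refl T
  exact ((((hTT.mul_right h3).mul_right hTT).add_right ((hTT.mul_right h3).smul_right ν)).add_right
    ((h3.mul_right hTT).smul_right ν)).add_right ((h3.smul_right ν).smul_right ν)

theorem balanced_of_core_min (hN : 0 < N)
    (hmin : ∀ W' G', coreObjective N lamW lamH A W G ≤ coreObjective N lamW lamH A W' G') :
    Balanced lamW W :=
  balanced_of_min hN fun W' => hmin W' G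

/-- By balance a positive multiple of `P Pᵀ` is the `(m + 1)`-st power of a multiple of the last
Gram matrix, which is positive semidefinite and can therefore be recovered as a root. -/
theorem commute_last_gram (hN : 0 < N) (hH : 0 < lamH) (hW : ∀ j, 0 < lamW j)
    (hmin : ∀ W' G', coreObjective N lamW lamH A W G ≤ coreObjective N lamW lamH A W' G') :
    Commute (lastLayer W * (lastLayer W)ᵀ) (A * Aᵀ) := by
  have h := (balanced_of_core_min hN hmin).prod_gram
  have hc := (commute_prod_gram hN hH hmin).smul_left (∏ j, lamW j)
  rw [h, smul_pow] at hc
  have hl : lamW (Fin.last m) ^ (m + 1) ≠ 0 := pow_ne_zero _ (hW _).ne'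
  have hc' := hc.smul_left (lamW (Fin.last m) ^ (m + 1))⁻¹
  rw [smul_smul, inv_mul_cancel₀ hl, one_smul] at hc'
  refine commute_of_commute_pow ?_ (Nat.succ_ne_zero m) hc'
  simpa using posSemidef_self_mul_conjTranspose (lastLayer W)

end CoreMin

/-! ### Joint diagonalization and singular value decompositions -/

section JointDiagonalization

variable {K : ℕ}

/-- The matrix whose columns are the vectors of an orthonormal basis. -/
noncomputable def basisMatrix (b : OrthonormalBasis (Fin K) ℝ (EuclideanSpace ℝ (Fin K))) :
    Matrix (Fin K) (Fin K) ℝ := Matrix.of fun i j => b j i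

theorem basisMatrix_mem (b : OrthonormalBasis (Fin K) ℝ (EuclideanSpace ℝ (Fin K))) :
    basisMatrix b ∈ orthogonalGroup (Fin K) ℝ := by
  rw [mem_orthogonalGroup_iff']
  ext i j
  have h := (orthonormal_iff_ite.1 b.orthonormal) j i
  simp only [PiLp.inner_apply, RCLike.inner_apply, conj_trivial] at h
  have h2 : ((basisMatrix b)ᵀ * basisMatrix b) i j = ∑ a, b i a * b j a := rfl
  refine h2.trans (h.trans ?_)
  rw [Matrix.one_apply]
  simp [eq_comm]

theorem exists_joint_eigenbasis {B Q : Matrix (Fin K) (Fin K) ℝ} (hB : B.IsHermitian)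
    (hQ : Q.IsHermitian) (hc : Commute B Q) :
    ∃ U ∈ orthogonalGroup (Fin K) ℝ, ∃ a q : Fin K → ℝ,
      Uᵀ * B * U = diagonal a ∧ Uᵀ * Q * U = diagonal q := by
  have hB' := isSymmetric_toEuclideanLin_iff.mpr hB
  have hQ' := isSymmetric_toEuclideanLin_iff.mpr hQ
  have hc' : Commute (toEuclideanLin B) (toEuclideanLin Q) := by
    refine LinearMap.ext fun v => ?_
    have h : B * Q = Q * B := hc
    simp only [Module.End.mul_apply, toLpLin_apply, mulVec_mulVec, h]
  have hint := LinearMap.IsSymmetric.directSum_isInternal_of_commute hB' hQ' hc'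
  have horth := LinearMap.IsSymmetric.orthogonalFamily_eigenspace_inf_eigenspace hB' hQ'
  -- The decomposition is indexed by all pairs of reals; only finitely many summands are nonzero,
  -- and a finite index type is needed to build the basis.
  rw [← DirectSum.isInternal_ne_bot_iff] at hint
  have := horth.independent.fintypeNeBotOfFiniteDimensional
  have horth' := horth.comp (Subtype.val_injective (p := fun i : ℝ × ℝ =>
    Module.End.eigenspace (toEuclideanLin B) i.2 ⊓
      Module.End.eigenspace (toEuclideanLin Q) i.1 ≠ ⊥))
  have hsub := fun i => hint.subordinateOrthonormalBasis_subordinate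
    (finrank_euclideanSpace_fin (𝕜 := ℝ) (n := K)) i horth'
  set b := hint.subordinateOrthonormalBasis
    (finrank_euclideanSpace_fin (𝕜 := ℝ) (n := K)) horth' with hb
  set f := fun i => (hint.subordinateOrthonormalBasisIndex
    (finrank_euclideanSpace_fin (𝕜 := ℝ) (n := K)) i horth').1 with hf
  have hU := basisMatrix_mem b
  have h1 : (basisMatrix b)ᵀ * basisMatrix b = 1 := (mem_orthogonalGroup_iff' _ ℝ).1 hU
  have key : ∀ (M : Matrix (Fin K) (Fin K) ℝ) (a : Fin K → ℝ),
      (∀ i, toEuclideanLin M (b i) = a i • b i) →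
        (basisMatrix b)ᵀ * M * basisMatrix b = diagonal a := by
    intro M a h
    have h2 : M * basisMatrix b = basisMatrix b * diagonal a := by
      ext i j
      have := congrArg (fun v : EuclideanSpace ℝ (Fin K) => v i) (h j)
      simp only [toLpLin_apply, PiLp.smul_apply, smul_eq_mul, mulVec, dotProduct] at this
      rw [Matrix.mul_apply, mul_diagonal]
      simp only [basisMatrix, of_apply]
      rw [this, mul_comm]
    rw [Matrix.mul_assoc, h2, ← Matrix.mul_assoc, h1, Matrix.one_mul]
  refine ⟨basisMatrix b, hU, fun i => (f i).2, fun i => (f i).1, key _ _ fun i => ?_,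
    key _ _ fun i => ?_⟩
  · exact Module.End.mem_eigenspace_iff.1 (Submodule.mem_inf.1 (hsub i)).1
  · exact Module.End.mem_eigenspace_iff.1 (Submodule.mem_inf.1 (hsub i)).2

theorem submatrix_mem_orthogonal {U : Matrix (Fin K) (Fin K) ℝ}
    (hU : U ∈ orthogonalGroup (Fin K) ℝ) (σ : Equiv.Perm (Fin K)) :
    U.submatrix id σ ∈ orthogonalGroup (Fin K) ℝ := by
  rw [mem_orthogonalGroup_iff] at hU ⊢
  rw [← hU]
  exact submatrix_mul_equiv U (star U) id σ id

/-- A matrix with orthogonal rows of norms `κ` is `diag κ` times an orthogonal matrix. -/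
theorem exists_right_factor {M : Matrix (Fin K) (Fin K) ℝ} {κ : Fin K → ℝ}
    (h : M * Mᵀ = diagonal (fun i => κ i ^ 2)) :
    ∃ V ∈ orthogonalGroup (Fin K) ℝ, M = diagonal κ * Vᵀ := by
  have hM : ∀ i j, ∑ a, M i a * M j a = if i = j then κ i ^ 2 else 0 := by
    intro i j
    have := congrFun (congrFun h i) j
    rwa [Matrix.mul_apply, diagonal_apply] at this
  let v : Fin K → EuclideanSpace ℝ (Fin K) := fun i => WithLp.toLp 2 fun a => (κ i)⁻¹ * M i a
  -- The nonzero rows, normalized, form an orthonormal family, which is extended to a basis without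
  -- moving its indices. Rows with `κ i = 0` vanish, so the added vectors do not matter.
  let s : Set (Fin K) := {i | κ i ≠ 0}
  have hv : Orthonormal ℝ (s.domRestrict v) := by
    rw [orthonormal_iff_ite]
    rintro ⟨i, hi⟩ ⟨j, hj⟩
    have h1 : inner ℝ (v i) (v j) = (κ i)⁻¹ * (κ j)⁻¹ * ∑ a, M i a * M j a := by
      simp only [v, PiLp.inner_apply, RCLike.inner_apply, conj_trivial, Finset.mul_sum]
      exact Finset.sum_congr rfl fun a _ => by ring
    have hi' : κ i ≠ 0 := hi
    simp only [Set.domRestrict_apply, h1, hM, Subtype.mk.injEq]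
    split_ifs with hij
    · subst hij
      field_simp
    · simp
  obtain ⟨b, hb⟩ := hv.exists_orthonormalBasis_extension_of_card_eq (by simp)
  refine ⟨basisMatrix b, basisMatrix_mem b, ?_⟩
  ext i a
  rw [diagonal_mul, transpose_apply, basisMatrix, of_apply]
  by_cases hi : κ i = 0
  · have h2 := hM i i
    simp only [if_true, hi] at h2
    have h3 := (Finset.sum_eq_zero_iff_of_nonneg (fun a _ => mul_self_nonneg (M i a))).1
      (h2.trans (by norm_num)) a (Finset.mem_univ a)
    rw [hi, zero_mul]
    exact mul_self_eq_zero.1 h3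
  · rw [hb i hi]
    simp only [v]
    field_simp

/-- A singular value decomposition of `A` that diagonalizes `Q` as well. -/
theorem exists_joint_svd {A Q : Matrix (Fin K) (Fin K) ℝ} (hQ : Q.IsHermitian)
    (hc : Commute Q (A * Aᵀ)) :
    ∃ U κ V q, IsSVD A U κ V ∧ Uᵀ * Q * U = diagonal q ∧
      ∀ i j, i ≤ j → κ i = κ j → q j ≤ q i := by
  obtain ⟨U₀, hU₀, a, q, ha, hq⟩ := exists_joint_eigenbasis
    (B := A * Aᵀ) (by simpa using isHermitian_mul_conjTranspose_self A) hQ hc.symm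
  -- Sorting lexicographically in decreasing order puts the larger eigenvalue of `Q` first inside
  -- each singular value; later this places active modes before inactive ones.
  let key : Fin K → ℝ ×ₗ ℝ := fun i => toLex (a i, q i)
  let τ : Equiv.Perm (Fin K) := Fin.revPerm.trans (Tuple.sort key)
  have hτ : Antitone fun i => key (τ i) := fun i j hij =>
    Tuple.monotone_sort key (Fin.rev_le_rev.2 hij)
  set U := U₀.submatrix id τ with hU
  have hUo : U ∈ orthogonalGroup (Fin K) ℝ := submatrix_mem_orthogonal hU₀ τ
  have hconj : ∀ (B : Matrix (Fin K) (Fin K) ℝ) (c : Fin K → ℝ), U₀ᵀ * B * U₀ = diagonal c →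
      Uᵀ * B * U = diagonal (c ∘ τ) := by
    intro B c h
    rw [← submatrix_diagonal_equiv, ← h]
    ext i j
    simp [hU, Matrix.mul_apply, submatrix_apply]
  have hA := hconj _ _ ha
  have hann : ∀ i, 0 ≤ a (τ i) := by
    intro i
    have h1 : Uᵀ * (A * Aᵀ) * U = (Uᵀ * A) * (Uᵀ * A)ᵀ := by
      rw [transpose_mul, transpose_transpose]; simp only [Matrix.mul_assoc]
    have h2 := congrFun (congrFun (h1.symm.trans hA) i) i
    rw [diagonal_apply_eq, Matrix.mul_apply] at h2
    rw [← Function.comp_apply (f := a), ← h2]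
    exact Finset.sum_nonneg fun j _ => mul_self_nonneg _
  let κ : Fin K → ℝ := fun i => √(a (τ i))
  have hM : (Uᵀ * A) * (Uᵀ * A)ᵀ = diagonal fun i => κ i ^ 2 := by
    have h1 : (fun i => κ i ^ 2) = a ∘ τ := by
      funext i
      exact Real.sq_sqrt (hann i)
    rw [h1, ← hA, transpose_mul, transpose_transpose]
    simp only [Matrix.mul_assoc]
  obtain ⟨V, hV, hMV⟩ := exists_right_factor hM
  have hle : ∀ i j, i ≤ j → a (τ j) < a (τ i) ∨ a (τ j) = a (τ i) ∧ q (τ j) ≤ q (τ i) :=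
    fun i j hij => Prod.Lex.le_iff.1 (hτ hij)
  refine ⟨U, κ, V, q ∘ τ, ⟨hUo, hV, fun i => Real.sqrt_nonneg _, ?_, ?_⟩, hconj _ _ hq, ?_⟩
  · intro i j hij
    rcases hle i j hij with h | h
    · exact Real.sqrt_le_sqrt h.le
    · exact Real.sqrt_le_sqrt h.1.le
  · have h1 : U * Uᵀ = 1 := (mem_orthogonalGroup_iff _ ℝ).1 hUo
    rw [Matrix.mul_assoc, ← hMV, ← Matrix.mul_assoc, h1, Matrix.one_mul]
  · intro i j hij h
    rcases hle i j hij with h1 | h1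
    · exact absurd h (Real.sqrt_lt_sqrt (hann j) h1).ne'
    · exact h1.2

theorem IsSVD.gram {A U V : Matrix (Fin K) (Fin K) ℝ} {κ : Fin K → ℝ} (h : IsSVD A U κ V) :
    A * Aᵀ = U * diagonal (fun i => κ i ^ 2) * Uᵀ := by
  have h1 : Vᵀ * V = 1 := (mem_orthogonalGroup_iff' _ ℝ).1 h.right_orth
  rw [h.eq]
  simp only [transpose_mul, transpose_transpose, diagonal_transpose]
  calc U * diagonal κ * Vᵀ * (V * (diagonal κ * Uᵀ))
      = U * diagonal κ * (Vᵀ * V) * diagonal κ * Uᵀ := by simp only [Matrix.mul_assoc]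
    _ = _ := by
      rw [h1, Matrix.mul_one, Matrix.mul_assoc U, diagonal_mul_diagonal]
      simp only [sq]

/-- The squares `κ i ^ 2` are the roots of the characteristic polynomial of `A Aᵀ` with
multiplicity, and a multiset has only one decreasing enumeration. -/
theorem IsSVD.unique {A U V U' V' : Matrix (Fin K) (Fin K) ℝ} {κ κ' : Fin K → ℝ}
    (h : IsSVD A U κ V) (h' : IsSVD A U' κ' V') : κ = κ' := by
  have hroots : ∀ {U V : Matrix (Fin K) (Fin K) ℝ} {κ : Fin K → ℝ}, IsSVD A U κ V →
      (A * Aᵀ).charpoly.roots = Multiset.map (fun i => κ i ^ 2) Finset.univ.val := by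
    intro U V κ h
    have h1 : Uᵀ * U = 1 := (mem_orthogonalGroup_iff' _ ℝ).1 h.left_orth
    rw [h.gram, charpoly_mul_comm, ← Matrix.mul_assoc, h1, Matrix.one_mul, charpoly_diagonal]
    rw [← Polynomial.roots_multiset_prod_X_sub_C (Multiset.map _ _), Multiset.map_map]
    rfl
  have hm := (hroots h).symm.trans (hroots h')
  rw [Fin.univ_val_map, Fin.univ_val_map, Multiset.coe_eq_coe] at hm
  have hanti : ∀ {κ : Fin K → ℝ}, (∀ k, 0 ≤ κ k) → Antitone κ → Antitone fun i => κ i ^ 2 :=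
    fun h0 h1 i j hij => pow_le_pow_left₀ (h0 j) (h1 hij) 2
  have h2 := List.ofFn_injective (hm.eq_of_pairwise'
    (hanti h.nonneg h.antitone).sortedGE_ofFn.pairwise
    (hanti h'.nonneg h'.antitone).sortedGE_ofFn.pairwise)
  funext i
  exact (pow_left_inj₀ (h.nonneg i) (h'.nonneg i) two_ne_zero).1 (congrFun h2 i)

end JointDiagonalization

/-- The rectangular diagonal matrix with diagonal entries `f 0, f 1, …`. -/
noncomputable def rectDiag (p q : ℕ) (f : ℕ → ℝ) : Matrix (Fin p) (Fin q) ℝ :=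
  Matrix.of fun a b => if (a : ℕ) = b then f a else 0

theorem rectDiag_one (p : ℕ) : rectDiag p p (fun _ => 1) = 1 := by
  ext a b
  simp [rectDiag, Matrix.one_apply, Fin.ext_iff]

theorem rectDiag_transpose (p q : ℕ) (f : ℕ → ℝ) : (rectDiag p q f)ᵀ = rectDiag q p f := by
  ext a b
  simp only [rectDiag, transpose_apply, of_apply]
  by_cases h : (a : ℕ) = b
  · simp [h]
  · simp [h, Ne.symm h]

theorem rectDiag_mul {p q s : ℕ} {f g : ℕ → ℝ} (hf : ∀ a, q ≤ a → f a = 0) :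
    rectDiag p q f * rectDiag q s g = rectDiag p s fun a => f a * g a := by
  ext a c
  rw [Matrix.mul_apply]
  simp only [rectDiag, of_apply]
  by_cases ha : (a : ℕ) < q
  · rw [Finset.sum_eq_single ⟨a, ha⟩]
    · simp
    · intro b _ hb
      have : (a : ℕ) ≠ b := fun h => hb (Fin.ext h.symm)
      simp [this]
    · simp
  · have h0 := hf a (not_lt.1 ha)
    simp [h0]

theorem frobSq_rectDiag {p q r : ℕ} {f : ℕ → ℝ} (hp : r ≤ p) (hq : r ≤ q)
    (hf : ∀ a, r ≤ a → f a = 0) : frobSq (rectDiag p q f) = ∑ a ∈ Finset.range r, f a ^ 2 := by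
  have h : ∀ a : Fin p, ∑ b : Fin q, rectDiag p q f a b ^ 2 = f a ^ 2 := by
    intro a
    simp only [rectDiag, of_apply]
    by_cases ha : (a : ℕ) < q
    · rw [Finset.sum_eq_single ⟨a, ha⟩]
      · simp
      · intro b _ hb
        have : (a : ℕ) ≠ b := fun h => hb (Fin.ext h.symm)
        simp [this]
      · simp
    · have h0 := hf a (hq.trans (not_lt.1 ha))
      simp [h0]
  rw [frobSq, Finset.sum_congr rfl fun a _ => h a, Fin.sum_univ_eq_sum_range (fun a => f a ^ 2)]
  symm
  refine Finset.sum_subset (Finset.range_subset_range.2 hp) fun a _ ha => ?_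
  rw [hf a (by simpa using ha)]
  simp

/-! ### Objective value and realization of a spectrum -/

section Value

variable {m : ℕ} {d : ℕ → ℕ} {N lamH Λ : ℝ} {lamW : Fin (m + 1) → ℝ}
  {W : Layers (m + 1) d} {G : Matrix (Fin (d 0)) (Fin (d (m + 1))) ℝ}
  {U V : Matrix (Fin (d (m + 1))) (Fin (d (m + 1))) ℝ} {κ x : Fin (d (m + 1)) → ℝ}

/-- The network and the features are diagonal in the frames `U`, `V`, with spectrum given
by `x`. -/
structure SpectralForm (N lamH Λ : ℝ) (lamW : Fin (m + 1) → ℝ) (W : Layers (m + 1) d)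
    (G : Matrix (Fin (d 0)) (Fin (d (m + 1))) ℝ)
    (U : Matrix (Fin (d (m + 1))) (Fin (d (m + 1))) ℝ) (κ : Fin (d (m + 1)) → ℝ)
    (V : Matrix (Fin (d (m + 1))) (Fin (d (m + 1))) ℝ) (x : Fin (d (m + 1)) → ℝ) : Prop where
  prod : Uᵀ * (layerProd W * (layerProd W)ᵀ) * U = diagonal fun i => N * lamH * x i ^ (m + 1)
  feat : G = (layerProd W)ᵀ * U * diagonal (fun i => κ i / (N * lamH * (x i ^ (m + 1) + 1))) * Vᵀ
  reg : ∑ j, lamW j * frobSq (W j) = (m + 1 : ℕ) * (Λ * ∑ i, x i)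

/-- The contribution of a singular value `κ` to the objective. -/
noncomputable def modeCost (m : ℕ) (N Λ κ x : ℝ) : ℝ :=
  (m + 1 : ℕ) * Λ * x + κ ^ 2 / N / (x ^ (m + 1) + 1)

/-- With `X = x^(m+1)`, the residual of a mode is `-κ / (X + 1)`. Data term and feature penalty
contribute `1` and `X` times `κ² / (2 N (X + 1)²)`, which add up to `κ² / (2 N (X + 1))`. -/
theorem SpectralForm.value (hN : 0 < N) (hH : 0 < lamH)
    (hU : U ∈ orthogonalGroup (Fin (d (m + 1))) ℝ) (hV : V ∈ orthogonalGroup (Fin (d (m + 1))) ℝ)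
    (hx : ∀ i, 0 ≤ x i) (h : SpectralForm N lamH Λ lamW W G U κ V x) :
    coreObjective N lamW lamH (U * diagonal κ * Vᵀ) W G
      = 1 / 2 * ∑ i, modeCost m N Λ (κ i) (x i) := by
  set P := layerProd W with hP
  have hUU : U * Uᵀ = 1 := (mem_orthogonalGroup_iff _ ℝ).1 hU
  set D : Matrix (Fin (d (m + 1))) (Fin (d (m + 1))) ℝ :=
    diagonal fun i => κ i / (N * lamH * (x i ^ (m + 1) + 1)) with hD
  have hG : G = Pᵀ * U * D * Vᵀ := h.feat
  have hprod : Uᵀ * (P * Pᵀ) * U = diagonal fun i => N * lamH * x i ^ (m + 1) := h.prod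
  have h1 : P * G - U * diagonal κ * Vᵀ = U * (diagonal (fun i => N * lamH * x i ^ (m + 1) *
      (κ i / (N * lamH * (x i ^ (m + 1) + 1))) - κ i)) * Vᵀ := by
    have h2 : P * G = U * (Uᵀ * (P * Pᵀ) * U * D) * Vᵀ := by
      calc P * G = (U * Uᵀ) * (P * Pᵀ * U * D * Vᵀ) := by
            rw [hUU, Matrix.one_mul, hG]; simp only [Matrix.mul_assoc]
        _ = _ := by simp only [Matrix.mul_assoc]
    rw [h2, hprod, hD, diagonal_mul_diagonal, ← Matrix.sub_mul, ← Matrix.mul_sub, diagonal_sub]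
  have hdiag : ∀ f : Fin (d (m + 1)) → ℝ, frobSq (diagonal f) = ∑ i, f i ^ 2 := by
    intro f
    rw [frobSq_eq_trace, diagonal_transpose, diagonal_mul_diagonal, trace_diagonal]
    simp only [sq]
  have h3 : frobSq G = ∑ i, N * lamH * x i ^ (m + 1) *
      (κ i / (N * lamH * (x i ^ (m + 1) + 1))) ^ 2 := by
    rw [hG, frobSq_mul_right (transpose_mem_orthogonal hV), ← frobSq_transpose, frobSq_eq_trace]
    have h4 : (Pᵀ * U * D)ᵀ * ((Pᵀ * U * D)ᵀ)ᵀ = D * (Uᵀ * (P * Pᵀ) * U) * D := by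
      simp only [transpose_mul, transpose_transpose, hD, diagonal_transpose, Matrix.mul_assoc]
    rw [h4, hprod, hD, diagonal_mul_diagonal, diagonal_mul_diagonal, trace_diagonal]
    exact Finset.sum_congr rfl fun i _ => by ring
  rw [coreObjective, ← hP, h1, frobSq_mul_right (transpose_mem_orthogonal hV),
    frobSq_mul_left hU, hdiag, h3, h.reg]
  simp only [Finset.mul_sum, ← Finset.sum_add_distrib]
  refine Finset.sum_congr rfl fun i _ => ?_
  have hX : 0 < x i ^ (m + 1) + 1 := add_pos_of_nonneg_of_pos (pow_nonneg (hx i) _) one_pos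
  rw [modeCost]
  generalize x i ^ (m + 1) = X at hX
  field_simp
  ring

theorem minWidth_le {L : ℕ} (d : ℕ → ℕ) {i : ℕ} (hi : i ≤ L) : minWidth L d ≤ d i :=
  Finset.inf'_le _ (Finset.mem_range.2 (Nat.lt_succ_iff.2 hi))

/-- Every spectrum supported on the first `r` modes is attained. -/
theorem exists_spectralForm (hW : ∀ j, 0 < lamW j) (hΛ : 0 < Λ)
    (hΛL : Λ ^ (m + 1) = N * (∏ j, lamW j) * lamH)
    (hU : U ∈ orthogonalGroup (Fin (d (m + 1))) ℝ) (κ : Fin (d (m + 1)) → ℝ)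
    (V : Matrix (Fin (d (m + 1))) (Fin (d (m + 1))) ℝ) (hx : ∀ i, 0 ≤ x i)
    (hr : ∀ i : Fin (d (m + 1)), minWidth (m + 1) d ≤ i → x i = 0) :
    ∃ W G, SpectralForm N lamH Λ lamW (d := d) W G U κ V x := by
  set r := minWidth (m + 1) d with hrdef
  let y : ℕ → ℝ := fun a => if h : a < d (m + 1) then x ⟨a, h⟩ else 0
  have hy0 : ∀ a, r ≤ a → y a = 0 := by
    intro a ha
    simp only [y]
    split_ifs with h
    · exact hr ⟨a, h⟩ ha
    · rfl
  have hynn : ∀ a, 0 ≤ y a := by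
    intro a
    simp only [y]
    split_ifs with h
    · exact hx _
    · exact le_rfl
  have hyx : ∀ i : Fin (d (m + 1)), y i = x i := fun i => by simp [y]
  -- This gives `λ_j f_j² = Λ y` in every layer, so the layers are balanced and, by `hΛL`, the
  -- squared product is `Λ^L y^L / ∏ λ_j = N λ_H y^L`.
  let f : Fin (m + 1) → ℕ → ℝ := fun j a => √(Λ * y a / lamW j)
  have hf0 : ∀ j a, r ≤ a → f j a = 0 := fun j a ha => by simp [f, hy0 a ha]
  have hfsq : ∀ j a, f j a ^ 2 = Λ * y a / lamW j := fun j a =>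
    Real.sq_sqrt (div_nonneg (mul_nonneg hΛ.le (hynn a)) (hW j).le)
  let W₀ : Layers (m + 1) d := fun j => rectDiag (d (j + 1)) (d j) (f j)
  have hpp : ∀ i (hi : i ≤ m + 1), partialProd W₀ i hi
      = rectDiag (d i) (d 0) fun a => ∏ j : Fin i, f ⟨j, lt_of_lt_of_le j.2 hi⟩ a := by
    intro i
    induction i with
    | zero =>
      intro hi
      simp only [Finset.univ_eq_empty, Finset.prod_empty]
      exact (rectDiag_one (d 0)).symm
    | succ i ih =>
      intro hi
      rw [partialProd_succ, ih]
      simp only [Fin.prod_univ_castSucc, Fin.val_castSucc, Fin.val_last]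
      have h1 := rectDiag_mul (p := d (i + 1)) (q := d i) (s := d 0) (f := f ⟨i, hi⟩)
        (g := fun a => ∏ j : Fin i, f ⟨j, lt_of_lt_of_le j.2 (Nat.le_of_succ_le hi)⟩ a)
        (fun a ha => hf0 _ a ((minWidth_le d (Nat.le_of_succ_le hi)).trans ha))
      refine h1.trans ?_
      congr 1
      funext a
      exact mul_comm _ _
  have hP₀ : layerProd W₀ = rectDiag (d (m + 1)) (d 0) fun a => ∏ j, f j a := hpp (m + 1) le_rfl
  -- Rotating only the last layer installs the frame `U` and changes no norm.
  let W : Layers (m + 1) d := Function.update W₀ (Fin.last m) (U * lastLayer W₀)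
  have hP : layerProd W = U * layerProd W₀ := by
    rw [layerProd_update_last, layerProd_eq_last_mul, Matrix.mul_assoc]
  have hUU : Uᵀ * U = 1 := (mem_orthogonalGroup_iff' _ ℝ).1 hU
  -- The features are whatever the field `feat` prescribes.
  refine ⟨W, _, ?_, rfl, ?_⟩
  · have h1 : Uᵀ * (layerProd W * (layerProd W)ᵀ) * U = layerProd W₀ * (layerProd W₀)ᵀ := by
      rw [hP, transpose_mul]
      calc Uᵀ * (U * layerProd W₀ * ((layerProd W₀)ᵀ * Uᵀ)) * U
          = (Uᵀ * U) * (layerProd W₀ * (layerProd W₀)ᵀ) * (Uᵀ * U) := by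
            simp only [Matrix.mul_assoc]
        _ = _ := by rw [hUU]; simp
    rw [h1, hP₀, rectDiag_transpose, rectDiag_mul]
    · ext i j
      simp only [rectDiag, of_apply, diagonal_apply, Fin.ext_iff]
      split_ifs with hij
      · rw [← Finset.prod_mul_distrib]
        simp only [← sq, hfsq, hyx]
        rw [Finset.prod_div_distrib, Finset.prod_const, Finset.card_univ, Fintype.card_fin,
          mul_pow, hΛL]
        have : ∏ j, lamW j ≠ 0 := Finset.prod_ne_zero_iff.2 fun j _ => (hW j).ne'
        field_simp
      · rfl
    · intro a ha
      exact Finset.prod_eq_zero (Finset.mem_univ 0)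
        (hf0 0 a ((minWidth_le d (Nat.zero_le _)).trans ha))
  · have h1 : ∀ j, lamW j * frobSq (W₀ j) = Λ * ∑ i, x i := by
      intro j
      have h2 := frobSq_rectDiag (minWidth_le d (i := j + 1) j.2)
        (minWidth_le d (i := j) j.2.le) (hf0 j)
      have h3 : ∑ i, x i = ∑ a ∈ Finset.range r, y a := by
        rw [← Finset.sum_congr rfl fun i _ => hyx i, Fin.sum_univ_eq_sum_range]
        symm
        refine Finset.sum_subset (Finset.range_subset_range.2 (minWidth_le d le_rfl))
          fun a _ ha => hy0 a (by simpa using ha)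
      have h4 : frobSq (W₀ j) = ∑ a ∈ Finset.range r, Λ * y a / lamW j := by
        refine h2.trans (Finset.sum_congr rfl fun a _ => hfsq j a)
      rw [h4, h3, Finset.mul_sum, Finset.mul_sum]
      refine Finset.sum_congr rfl fun a _ => ?_
      have := (hW j).ne'
      field_simp
    rw [sum_update_last, frobSq_mul_left hU, sub_self, mul_zero, add_zero,
      Finset.sum_congr rfl fun j _ => h1 j]
    simp

end Value

/-! ### The scalar problem of a single mode -/

section OneMode

/-- The constant `(L - 1)^((L - 1)/L)` with `L = m + 1`. -/
noncomputable def theta (m : ℕ) : ℝ := (m : ℝ) ^ ((m : ℝ) / ((m + 1 : ℕ) : ℝ))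

theorem threshRight_eq (m : ℕ) (κ : ℝ) : threshRight (m + 1) κ = κ ^ 2 * theta m := by
  rw [threshRight, theta]
  push_cast
  rw [add_sub_cancel_right]

theorem theta_zero : theta 0 = 1 := by simp [theta]

/-- Weighted AM-GM for `x^(m+1) / m` and `1` with weights `m / (m+1)` and `1 / (m+1)`. Equality
holds at `x^(m+1) = m`, hence the sharp threshold constant. -/
theorem young_theta (m : ℕ) {x : ℝ} (hx : 0 ≤ x) :
    (m + 1 : ℕ) * x ^ m ≤ theta m * (x ^ (m + 1) + 1) := by
  rcases Nat.eq_zero_or_pos m with rfl | hm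
  · rw [theta_zero]; simp; exact hx
  have hm' : (0 : ℝ) < m := by exact_mod_cast hm
  have hL : (0 : ℝ) < ((m + 1 : ℕ) : ℝ) := by positivity
  have h := Real.geom_mean_le_arith_mean2_weighted (w₁ := (m : ℝ) / ((m + 1 : ℕ) : ℝ))
    (w₂ := 1 / ((m + 1 : ℕ) : ℝ)) (p₁ := x ^ (m + 1) / m) (p₂ := 1) (by positivity)
    (by positivity) (by positivity) zero_le_one (by push_cast; field_simp)
  have h1 : (x ^ (m + 1) / m) ^ ((m : ℝ) / ((m + 1 : ℕ) : ℝ)) = x ^ m / theta m := by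
    rw [Real.div_rpow (by positivity) hm'.le, ← Real.rpow_natCast x (m + 1), ← Real.rpow_mul hx,
      mul_div_cancel₀ _ hL.ne', Real.rpow_natCast, theta]
  have hθ : 0 < theta m := Real.rpow_pos_of_pos hm' _
  rw [h1, Real.one_rpow, mul_one, div_le_iff₀ hθ] at h
  have h2 : (m : ℝ) / ((m + 1 : ℕ) : ℝ) * (x ^ (m + 1) / m) + 1 / ((m + 1 : ℕ) : ℝ) * 1
      = (x ^ (m + 1) + 1) / ((m + 1 : ℕ) : ℝ) := by
    field_simp
  rw [h2, div_mul_eq_mul_div, le_div_iff₀ hL] at h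
  linarith

variable {m : ℕ} {N Λ κ x : ℝ}

theorem modeCost_zero : modeCost m N Λ κ 0 = κ ^ 2 / N := by
  simp [modeCost]

/-- A nonzero mode that does not increase the cost. -/
theorem le_of_modeCost_le (hx : 0 < x) (h : modeCost m N Λ κ x ≤ modeCost m N Λ κ 0) :
    (m + 1 : ℕ) * Λ * (x ^ (m + 1) + 1) ≤ κ ^ 2 / N * x ^ m := by
  rw [modeCost_zero, modeCost] at h
  have hX : 0 < x ^ (m + 1) + 1 := by positivity
  have h1 : κ ^ 2 / N / (x ^ (m + 1) + 1) * (x ^ (m + 1) + 1) = κ ^ 2 / N :=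
    div_mul_cancel₀ _ hX.ne'
  have h2 := mul_le_mul_of_nonneg_right h hX.le
  rw [add_mul, h1] at h2
  have h3 : x * ((m + 1 : ℕ) * Λ * (x ^ (m + 1) + 1)) ≤ x * (κ ^ 2 / N * x ^ m) := by
    have : x ^ (m + 1) = x * x ^ m := pow_succ' x m
    rw [this] at h2 ⊢
    linarith
  exact le_of_mul_le_mul_left h3 hx

/-- Not exceeding the cost at `0` bounds `x^m / (x^(m+1) + 1)` from below, while `young_theta`
bounds it from above by `theta m / (m + 1)`. -/
theorem thresh_of_modeCost_le (hN : 0 < N) (hx : 0 < x)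
    (h : modeCost m N Λ κ x ≤ modeCost m N Λ κ 0) :
    Λ * ((m + 1 : ℕ) : ℝ) ^ 2 * N ≤ κ ^ 2 * theta m := by
  have h1 := le_of_modeCost_le hx h
  have h2 := young_theta m hx.le
  have hX : 0 < x ^ (m + 1) + 1 := by positivity
  have hL : (0 : ℝ) < ((m + 1 : ℕ) : ℝ) := by positivity
  have ha : 0 ≤ κ ^ 2 / N := by positivity
  have h3 : (Λ * ((m + 1 : ℕ) : ℝ) ^ 2) * (x ^ (m + 1) + 1)
      ≤ κ ^ 2 / N * theta m * (x ^ (m + 1) + 1) := by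
    nlinarith [mul_le_mul_of_nonneg_left h2 ha, mul_le_mul_of_nonneg_left h1 hL.le]
  have h4 := le_of_mul_le_mul_right h3 hX
  rw [div_mul_eq_mul_div, le_div_iff₀ hN] at h4
  exact h4

/-- For one layer the comparison reads `Λ (x + 1) ≤ κ² / N`, which is strict at the threshold since
`x > 0`. This is why condition (i) is only needed for `L ≥ 2`. -/
theorem thresh_lt_of_modeCost_le (hN : 0 < N) (hΛ : 0 < Λ) (hx : 0 < x)
    (h : modeCost 0 N Λ κ x ≤ modeCost 0 N Λ κ 0) :
    Λ * ((0 + 1 : ℕ) : ℝ) ^ 2 * N < κ ^ 2 * theta 0 := by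
  have h1 := le_of_modeCost_le hx h
  rw [theta_zero]
  simp only [zero_add, Nat.cast_one, one_mul, pow_one, pow_zero, mul_one, one_pow] at h1 ⊢
  rw [le_div_iff₀ hN] at h1
  nlinarith [mul_pos (mul_pos hΛ hx) hN]

theorem exists_modeCost_lt (hN : 0 < N) (hΛ : 0 < Λ)
    (h : Λ * ((m + 1 : ℕ) : ℝ) ^ 2 * N < κ ^ 2 * theta m) :
    ∃ y, 0 < y ∧ modeCost m N Λ κ y < modeCost m N Λ κ 0 := by
  rw [← lt_div_iff₀ hN, mul_div_right_comm] at h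
  simp only [modeCost_zero]
  simp only [modeCost]
  generalize κ ^ 2 / N = a at h
  rcases Nat.eq_zero_or_pos m with rfl | hm
  · rw [theta_zero] at h
    simp only [zero_add, Nat.cast_one, one_pow, mul_one, pow_one, one_mul] at h ⊢
    -- The cost lies below its value at `0` exactly for `0 < y < (a - Λ) / Λ`; the midpoint is
    -- taken.
    refine ⟨(a - Λ) / (2 * Λ), by have := sub_pos.2 h; positivity, ?_⟩
    have h1 : (a - Λ) / (2 * Λ) + 1 = (a + Λ) / (2 * Λ) := by field_simp; ring
    have h2 : Λ * ((a - Λ) / (2 * Λ)) = (a - Λ) / 2 := by field_simp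
    have h3 : 0 < a + Λ := by linarith
    rw [h1, h2, div_div_eq_mul_div, ← lt_sub_iff_add_lt', div_lt_iff₀ h3]
    nlinarith
  · have hm' : (0 : ℝ) < m := by exact_mod_cast hm
    have hL : ((m + 1 : ℕ) : ℝ) ≠ 0 := by positivity
    -- The equality case of `young_theta`.
    set y : ℝ := (m : ℝ) ^ (1 / ((m + 1 : ℕ) : ℝ)) with hy
    have hy0 : 0 < y := Real.rpow_pos_of_pos hm' _
    have hyL : y ^ (m + 1) = m := by
      rw [hy, ← Real.rpow_natCast, ← Real.rpow_mul hm'.le, one_div, inv_mul_cancel₀ hL,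
        Real.rpow_one]
    have hym : y ^ m = theta m := by
      rw [hy, ← Real.rpow_natCast, ← Real.rpow_mul hm'.le, theta]
      congr 1
      ring
    refine ⟨y, hy0, ?_⟩
    rw [hyL]
    have h1 : y * theta m = m := by rw [← hym, ← pow_succ', hyL]
    have h2 : (0 : ℝ) < (m : ℝ) + 1 := by positivity
    have h3 := mul_lt_mul_of_pos_left h hy0
    push_cast at h3 ⊢
    rw [← lt_sub_iff_add_lt]
    have h4 : a - a / ((m : ℝ) + 1) = a * m / (m + 1) := by field_simp; ring
    rw [h4, lt_div_iff₀ h2]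
    have h5 : y * (a * theta m) = a * m := by rw [← h1]; ring
    nlinarith

/-- Exchanging an inactive mode with an active mode of smaller singular value pays off. -/
theorem modeCost_swap_lt (hN : 0 < N) {κ' : ℝ} (hκ : 0 ≤ κ) (hκ' : κ < κ') (hx : 0 < x) :
    modeCost m N Λ κ' x + modeCost m N Λ κ 0 < modeCost m N Λ κ x + modeCost m N Λ κ' 0 := by
  simp only [modeCost_zero]
  simp only [modeCost]
  have hX : 1 < x ^ (m + 1) + 1 := by have := pow_pos hx (m + 1); linarith
  have h1 : κ ^ 2 / N < κ' ^ 2 / N := by gcongr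
  have h2 : (κ' ^ 2 / N - κ ^ 2 / N) / (x ^ (m + 1) + 1) < κ' ^ 2 / N - κ ^ 2 / N :=
    div_lt_self (sub_pos.2 h1) hX
  rw [sub_div] at h2
  linarith

/-- Rearranged, this is `u^m - 1 < X u^m (u - 1)`, and `u^m - 1` is `u - 1` times a sum of `m`
powers of `u`, each at most `u^m`. For `m = 0` strictness comes from `X > 0`. -/
theorem pow_add_one_lt {u X : ℝ} (hu : 1 < u) (hX : (m : ℝ) ≤ X) (hX0 : 0 < X) :
    (X + 1) * u ^ m < u ^ (m + 1) * X + 1 := by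
  have h1 : u ^ m - 1 ≤ m * u ^ m * (u - 1) ∧ (0 < m → u ^ m - 1 < m * u ^ m * (u - 1)) := by
    clear hX
    induction m with
    | zero => simp
    | succ k ih =>
      have h2 : u ^ (k + 1) - 1 < ((k + 1 : ℕ) : ℝ) * u ^ (k + 1) * (u - 1) := by
        have hk : 0 < u ^ k := by positivity
        have e : u ^ (k + 1) = u * u ^ k := pow_succ' u k
        have hk0 : (0 : ℝ) ≤ k := Nat.cast_nonneg k
        push_cast
        rw [e]
        have h3 : 0 < u ^ k * (u - 1) ^ 2 := by
          have := sub_pos.2 hu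
          positivity
        have h4 : 0 ≤ k * (u ^ k * (u - 1) ^ 2) := by positivity
        nlinarith [ih.1]
      exact ⟨h2.le, fun _ => h2⟩
  have hum : 0 < u ^ m := by positivity
  have h5 : u ^ m - 1 < X * u ^ m * (u - 1) := by
    rcases Nat.eq_zero_or_pos m with rfl | hm
    · simp only [pow_zero, sub_self, mul_one]
      exact mul_pos hX0 (sub_pos.2 hu)
    · refine (h1.2 hm).trans_le ?_
      have := sub_pos.2 hu
      gcongr
  rw [pow_succ]
  nlinarith

/-- Stationarity makes `x` a root; comparison with `0` adds `x^(m+1) ≥ m`, and beyond such a point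
`x^m / (x^(m+1) + 1)²` stays strictly below its value there, so no larger root exists. -/
theorem largestRoot_of_minimizer (hN : 0 < N) (hΛ : 0 < Λ) (hx : 0 < x)
    (h : ∀ y, 0 ≤ y → modeCost m N Λ κ x ≤ modeCost m N Λ κ y) :
    IsLargestRoot (m + 1) (N / κ ^ 2 * Λ) x := by
  have hX : 0 < x ^ (m + 1) + 1 := by positivity
  have hL : (0 : ℝ) < ((m + 1 : ℕ) : ℝ) := by positivity
  have hcrit : Λ * (x ^ (m + 1) + 1) ^ 2 = κ ^ 2 / N * x ^ m := by
    have hmin : IsLocalMin (modeCost m N Λ κ) x := by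
      filter_upwards [eventually_gt_nhds hx] with y hy using h y hy.le
    have hd : HasDerivAt (modeCost m N Λ κ)
        ((m + 1 : ℕ) * Λ * 1 +
          (0 * (x ^ (m + 1) + 1) - κ ^ 2 / N * (((m + 1 : ℕ) : ℝ) * x ^ m * 1))
            / (x ^ (m + 1) + 1) ^ 2) x := by
      refine ((hasDerivAt_id x).const_mul _).add
        ((hasDerivAt_const x (κ ^ 2 / N)).div (((hasDerivAt_id x).pow (m + 1)).add_const 1) hX.ne')
    have h0 := hmin.hasDerivAt_eq_zero hd
    field_simp at h0
    have h1 : Λ * (x ^ (m + 1) + 1) ^ 2 * N = κ ^ 2 * x ^ m := by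
      refine mul_left_cancel₀ hL.ne' ?_
      linarith
    field_simp
    linarith
  have hκ : κ ≠ 0 := by
    rintro rfl
    have : 0 < Λ * (x ^ (m + 1) + 1) ^ 2 := by positivity
    rw [hcrit] at this
    simp at this
  have hα : N / κ ^ 2 * Λ = x ^ m / (x ^ (m + 1) + 1) ^ 2 := by
    rw [eq_div_iff (by positivity), mul_assoc, hcrit]
    field_simp
  -- Inserting `hcrit` in the comparison with `0` and cancelling `Λ (x^(m+1) + 1)` leaves `m + 1 ≤
  -- x^(m+1) + 1`.
  have hge : (m : ℝ) ≤ x ^ (m + 1) := by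
    have h1 := le_of_modeCost_le hx (h 0 le_rfl)
    rw [← hcrit] at h1
    have h2 : ((m + 1 : ℕ) : ℝ) * (Λ * (x ^ (m + 1) + 1))
        ≤ (x ^ (m + 1) + 1) * (Λ * (x ^ (m + 1) + 1)) := by linarith
    have h3 := le_of_mul_le_mul_right h2 (by positivity)
    push_cast at h3
    linarith
  refine ⟨⟨hX.ne', by rw [hα, Nat.add_sub_cancel, sub_self]⟩, ?_⟩
  rintro y ⟨hy1, hy2⟩
  by_contra! hxy
  have hy0 : 0 < y := hx.trans hxy
  rw [hα, Nat.add_sub_cancel, sub_eq_zero] at hy2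
  obtain ⟨u, rfl⟩ : ∃ u, y = u * x := ⟨y / x, by field_simp⟩
  have hu : 1 < u := by
    by_contra! hu
    nlinarith
  have h1 := pow_add_one_lt (m := m) hu hge (by positivity)
  have hum : 1 ≤ u ^ m := one_le_pow₀ hu.le
  have hY : 0 < (u * x) ^ (m + 1) + 1 := by positivity
  rw [div_eq_div_iff (by positivity) (by positivity), mul_pow, mul_pow] at hy2
  have hxm : 0 < x ^ m := by positivity
  have h2 : (u ^ (m + 1) * x ^ (m + 1) + 1) ^ 2 = u ^ m * (x ^ (m + 1) + 1) ^ 2 := by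
    have : x ^ m * (u ^ (m + 1) * x ^ (m + 1) + 1) ^ 2
        = x ^ m * (u ^ m * (x ^ (m + 1) + 1) ^ 2) := by linarith
    exact mul_left_cancel₀ hxm.ne' this
  have h3 : ((x ^ (m + 1) + 1) * u ^ m) ^ 2 < (u ^ (m + 1) * x ^ (m + 1) + 1) ^ 2 := by
    have : 0 ≤ (x ^ (m + 1) + 1) * u ^ m := by positivity
    gcongr
  rw [h2, mul_pow] at h3
  have h4 : u ^ m * (x ^ (m + 1) + 1) ^ 2 ≤ (x ^ (m + 1) + 1) ^ 2 * (u ^ m) ^ 2 := by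
    have : u ^ m * 1 ≤ u ^ m * u ^ m := by gcongr
    have := mul_le_mul_of_nonneg_left this (sq_nonneg (x ^ (m + 1) + 1))
    linarith
  linarith

end OneMode

theorem conj_orth_pow {K : ℕ} {U : Matrix (Fin K) (Fin K) ℝ}
    (hU : U ∈ orthogonalGroup (Fin K) ℝ) (M : Matrix (Fin K) (Fin K) ℝ) (k : ℕ) :
    Uᵀ * M ^ k * U = (Uᵀ * M * U) ^ k := by
  have h1 : Uᵀ * U = 1 := (mem_orthogonalGroup_iff' _ ℝ).1 hU
  have h2 : U * Uᵀ = 1 := (mem_orthogonalGroup_iff _ ℝ).1 hU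
  induction k with
  | zero => simp [h1]
  | succ k ih =>
    rw [pow_succ (Uᵀ * M * U), ← ih, pow_succ]
    calc Uᵀ * (M ^ k * M) * U = Uᵀ * M ^ k * 1 * M * U := by
          rw [Matrix.mul_one]; simp only [Matrix.mul_assoc]
      _ = _ := by rw [← h2]; simp only [Matrix.mul_assoc]

/-! ### Spectral form of a minimizer -/

section Spectral

variable {m : ℕ} {d : ℕ → ℕ} {N lamH Λ : ℝ} {lamW : Fin (m + 1) → ℝ}
  {A : Matrix (Fin (d (m + 1))) (Fin (d (m + 1))) ℝ} {W : Layers (m + 1) d}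
  {G : Matrix (Fin (d 0)) (Fin (d (m + 1))) ℝ}
  {U V : Matrix (Fin (d (m + 1))) (Fin (d (m + 1))) ℝ} {κ x : Fin (d (m + 1)) → ℝ}

theorem spectrum_nonneg (hΛ : 0 < Λ) (hW : ∀ j, 0 < lamW j)
    (hq : Uᵀ * (lastLayer W * (lastLayer W)ᵀ) * U
      = diagonal fun i => Λ * x i / lamW (Fin.last m)) (i : Fin (d (m + 1))) : 0 ≤ x i := by
  have h1 : Uᵀ * (lastLayer W * (lastLayer W)ᵀ) * U
      = (Uᵀ * lastLayer W) * (Uᵀ * lastLayer W)ᵀ := by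
    rw [transpose_mul, transpose_transpose]; simp only [Matrix.mul_assoc]
  have h2 := congrFun (congrFun (h1.symm.trans hq) i) i
  rw [diagonal_apply_eq, Matrix.mul_apply] at h2
  have h3 : 0 ≤ Λ * x i / lamW (Fin.last m) := by
    rw [← h2]
    exact Finset.sum_nonneg fun j _ => mul_self_nonneg _
  have h4 : x i = Λ * x i / lamW (Fin.last m) * (lamW (Fin.last m) / Λ) := by
    have := (hW (Fin.last m)).ne'
    field_simp
  rw [h4]
  exact mul_nonneg h3 (div_nonneg (hW _).le hΛ.le)

/-- Balance turns the spectrum of the last Gram matrix into that of `P Pᵀ` and into the regularizer;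
the normal equation then splits in the frames `U`, `V` into scalar equations. Any singular value
decomposition diagonalizing the last Gram matrix will do, which lets the lemma serve both claims. -/
theorem spectralForm_of_min (hN : 0 < N) (hH : 0 < lamH) (hW : ∀ j, 0 < lamW j) (hΛ : 0 < Λ)
    (hΛL : Λ ^ (m + 1) = N * (∏ j, lamW j) * lamH)
    (hmin : ∀ W' G', coreObjective N lamW lamH A W G ≤ coreObjective N lamW lamH A W' G')
    (hsvd : IsSVD A U κ V)
    (hq : Uᵀ * (lastLayer W * (lastLayer W)ᵀ) * U
      = diagonal fun i => Λ * x i / lamW (Fin.last m)) :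
    SpectralForm N lamH Λ lamW W G U κ V x := by
  have hU := hsvd.left_orth
  have hUtU : Uᵀ * U = 1 := (mem_orthogonalGroup_iff' _ ℝ).1 hU
  have hUUt : U * Uᵀ = 1 := (mem_orthogonalGroup_iff _ ℝ).1 hU
  have hVtV : Vᵀ * V = 1 := (mem_orthogonalGroup_iff' _ ℝ).1 hsvd.right_orth
  have hVVt : V * Vᵀ = 1 := (mem_orthogonalGroup_iff _ ℝ).1 hsvd.right_orth
  have hx := spectrum_nonneg hΛ hW hq
  have hb := balanced_of_core_min hN hmin
  have hl := (hW (Fin.last m)).ne'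
  have hprod : Uᵀ * (layerProd W * (layerProd W)ᵀ) * U
      = diagonal fun i => N * lamH * x i ^ (m + 1) := by
    have hp : ∏ j, lamW j ≠ 0 := Finset.prod_ne_zero_iff.2 fun j _ => (hW j).ne'
    refine smul_right_injective _ hp ?_
    show (∏ j, lamW j) • (Uᵀ * (layerProd W * (layerProd W)ᵀ) * U) = (∏ j, lamW j) • _
    rw [← Matrix.smul_mul, ← Matrix.mul_smul, hb.prod_gram, conj_orth_pow hU, Matrix.mul_smul,
      Matrix.smul_mul, hq, ← diagonal_smul, diagonal_pow, ← diagonal_smul]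
    congr 1
    funext i
    simp only [Pi.pow_apply, Pi.smul_apply, smul_eq_mul]
    rw [mul_div_cancel₀ _ hl, mul_pow, hΛL]
    ring
  refine ⟨hprod, ?_, ?_⟩
  · obtain ⟨X, hG, hA⟩ := exists_feature_factor hN hH hmin
    set T := layerProd W * (layerProd W)ᵀ
    set ν := N * lamH
    have hν : 0 < ν := mul_pos hN hH
    set Y := Uᵀ * X * V with hY
    have hXY : X = U * Y * Vᵀ := by
      calc X = (U * Uᵀ) * X * (V * Vᵀ) := by rw [hUUt, hVVt]; simp
        _ = _ := by simp only [hY, Matrix.mul_assoc]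
    have h1 : Uᵀ * T * U * Y + ν • Y = diagonal κ := by
      have h2 : Uᵀ * A * V = diagonal κ := by
        rw [hsvd.eq]
        calc Uᵀ * (U * diagonal κ * Vᵀ) * V = (Uᵀ * U) * diagonal κ * (Vᵀ * V) := by
              simp only [Matrix.mul_assoc]
          _ = _ := by rw [hUtU, hVtV]; simp
      rw [← h2, ← hA, Matrix.mul_add, Matrix.add_mul, Matrix.mul_smul, Matrix.smul_mul]
      congr 1
      calc Uᵀ * T * U * Y = Uᵀ * T * (U * Uᵀ) * X * V := by simp only [hY, Matrix.mul_assoc]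
        _ = _ := by rw [hUUt, Matrix.mul_one, Matrix.mul_assoc Uᵀ T X]
    have hYD : Y = diagonal fun i => κ i / (ν * (x i ^ (m + 1) + 1)) := by
      ext i j
      have h3 := congrFun (congrFun h1 i) j
      rw [hprod, Matrix.add_apply, diagonal_mul, Matrix.smul_apply, smul_eq_mul] at h3
      have h4 : 0 < ν * (x i ^ (m + 1) + 1) :=
        mul_pos hν (add_pos_of_nonneg_of_pos (pow_nonneg (hx i) _) one_pos)
      have h5 : ν * (x i ^ (m + 1) + 1) * Y i j = diagonal κ i j := by rw [← h3]; ring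
      rw [diagonal_apply] at h5 ⊢
      split_ifs at h5 ⊢ with hij
      · rw [eq_div_iff h4.ne', ← h5, mul_comm]
      · exact (mul_eq_zero.1 h5).resolve_left h4.ne'
    rw [hG, hXY, hYD]
    simp only [Matrix.mul_assoc]
  · rw [hb.sum_frobSq]
    have h1 : trace (lastLayer W * (lastLayer W)ᵀ) = ∑ i, Λ * x i / lamW (Fin.last m) := by
      rw [← trace_diagonal, ← hq, trace_mul_comm (Uᵀ * _), ← Matrix.mul_assoc, hUUt,
        Matrix.one_mul]
    rw [h1, ← Finset.sum_div, ← Finset.mul_sum, mul_div_cancel₀ _ hl]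

theorem factorization_permute {K : ℕ} {A U V : Matrix (Fin K) (Fin K) ℝ} {κ : Fin K → ℝ}
    (h : A = U * diagonal κ * Vᵀ) (τ : Equiv.Perm (Fin K)) :
    A = U.submatrix id τ * diagonal (κ ∘ τ) * (V.submatrix id τ)ᵀ := by
  rw [← submatrix_diagonal_equiv, transpose_submatrix, submatrix_mul_equiv, submatrix_mul_equiv,
    ← h]
  rfl

/-- The spectrum of a minimizer is optimal among all spectra of at most `r` modes. -/
theorem spectrum_optimal (hN : 0 < N) (hH : 0 < lamH) (hW : ∀ j, 0 < lamW j) (hΛ : 0 < Λ)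
    (hΛL : Λ ^ (m + 1) = N * (∏ j, lamW j) * lamH)
    (hmin : ∀ W' G', coreObjective N lamW lamH A W G ≤ coreObjective N lamW lamH A W' G')
    (hsvd : IsSVD A U κ V) (hx : ∀ i, 0 ≤ x i)
    (hform : SpectralForm N lamH Λ lamW W G U κ V x) (y : Fin (d (m + 1)) → ℝ)
    (hy : ∀ i, 0 ≤ y i) (hcard : (Finset.univ.filter fun i => y i ≠ 0).card ≤ minWidth (m + 1) d) :
    ∑ i, modeCost m N Λ (κ i) (x i) ≤ ∑ i, modeCost m N Λ (κ i) (y i) := by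
  -- `exists_spectralForm` only realizes spectra living on the first `r` indices, so `y` is sorted
  -- decreasingly and the frames are permuted along. The permuted `κ` need not be decreasing;
  -- `SpectralForm.value` does not ask for it.
  let τ : Equiv.Perm (Fin (d (m + 1))) := Fin.revPerm.trans (Tuple.sort y)
  have hτ : Antitone fun i => y (τ i) := fun i j hij =>
    Tuple.monotone_sort y (Fin.rev_le_rev.2 hij)
  have hr : ∀ i : Fin (d (m + 1)), minWidth (m + 1) d ≤ i → (y ∘ τ) i = 0 := by
    intro i hi
    by_contra hne
    have h1 : (Finset.Iic i).image τ ⊆ Finset.univ.filter fun i => y i ≠ 0 := by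
      intro k hk
      obtain ⟨j, hj, rfl⟩ := Finset.mem_image.1 hk
      have h2 : y (τ i) ≤ y (τ j) := hτ (Finset.mem_Iic.1 hj)
      have h3 : 0 < y (τ i) := lt_of_le_of_ne (hy _) (Ne.symm hne)
      simpa using (h3.trans_le h2).ne'
    have h4 := (Finset.card_le_card h1).trans hcard
    rw [Finset.card_image_of_injective _ τ.injective, Fin.card_Iic] at h4
    omega
  have hU' := submatrix_mem_orthogonal hsvd.left_orth τ
  have hV' := submatrix_mem_orthogonal hsvd.right_orth τ
  obtain ⟨W', G', h'⟩ := exists_spectralForm hW hΛ hΛL hU' (κ ∘ τ) (V.submatrix id τ)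
    (x := y ∘ τ) (fun i => hy _) hr
  have h1 := hmin W' G'
  have h2 : coreObjective N lamW lamH A W G = 1 / 2 * ∑ i, modeCost m N Λ (κ i) (x i) := by
    rw [hsvd.eq]
    exact hform.value hN hH hsvd.left_orth hsvd.right_orth hx
  have h3 : coreObjective N lamW lamH A W' G'
      = 1 / 2 * ∑ i, modeCost m N Λ ((κ ∘ τ) i) ((y ∘ τ) i) := by
    rw [factorization_permute hsvd.eq τ]
    exact h'.value hN hH hU' hV' fun i => hy _
  have h4 : ∑ i, modeCost m N Λ ((κ ∘ τ) i) ((y ∘ τ) i) = ∑ i, modeCost m N Λ (κ i) (y i) :=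
    Equiv.sum_comp τ fun i => modeCost m N Λ (κ i) (y i)
  rw [h2, h3, h4] at h1
  linarith

theorem card_spectrum_le (hN : 0 < N) (hH : 0 < lamH)
    (hform : SpectralForm N lamH Λ lamW W G U κ V x) :
    (Finset.univ.filter fun i => x i ≠ 0).card ≤ minWidth (m + 1) d := by
  have h1 := congrArg Matrix.rank hform.prod
  rw [rank_diagonal, Fintype.card_subtype] at h1
  have h2 : (Finset.univ.filter fun i => x i ≠ 0)
      = Finset.univ.filter fun i => N * lamH * x i ^ (m + 1) ≠ 0 := by
    ext i
    simp [hN.ne', hH.ne']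
  rw [h2, ← h1]
  calc (Uᵀ * (layerProd W * (layerProd W)ᵀ) * U).rank
      ≤ (layerProd W * (layerProd W)ᵀ).rank :=
        (rank_mul_le_left _ _).trans (rank_mul_le_right _ _)
    _ ≤ (layerProd W).rank := rank_mul_le_left _ _
    _ ≤ _ := rank_layerProd_le W

end Spectral

/-! ### Combinatorics of optimal spectra -/

section Optimal

variable {K m r : ℕ} {N Λ : ℝ} {κ x : Fin K → ℝ}

/-- `x` minimizes the total cost among nonnegative spectra of at most `r` modes. -/
structure IsOptimalSpectrum (m r : ℕ) (N Λ : ℝ) (κ x : Fin K → ℝ) : Prop where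
  nonneg : ∀ i, 0 ≤ x i
  card_le : (Finset.univ.filter fun i => x i ≠ 0).card ≤ r
  le : ∀ y : Fin K → ℝ, (∀ i, 0 ≤ y i) → (Finset.univ.filter fun i => y i ≠ 0).card ≤ r →
    ∑ i, modeCost m N Λ (κ i) (x i) ≤ ∑ i, modeCost m N Λ (κ i) (y i)

namespace IsOptimalSpectrum

theorem le_update (h : IsOptimalSpectrum m r N Λ κ x) (i : Fin K) {y : ℝ} (hy : 0 ≤ y)
    (hc : (Finset.univ.filter fun k => Function.update x i y k ≠ 0).card ≤ r) :
    modeCost m N Λ (κ i) (x i) ≤ modeCost m N Λ (κ i) y := by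
  have h1 := h.le (Function.update x i y) (fun k => by
    rcases eq_or_ne k i with rfl | hk
    · simpa using hy
    · rw [Function.update_of_ne hk]; exact h.nonneg k) hc
  rw [← sub_nonneg, ← Finset.sum_sub_distrib, Fintype.sum_eq_single i] at h1
  · simpa using h1
  · intro k hk
    rw [Function.update_of_ne hk, sub_self]

theorem minimizes (h : IsOptimalSpectrum m r N Λ κ x) {i : Fin K} (hi : x i ≠ 0) (y : ℝ)
    (hy : 0 ≤ y) : modeCost m N Λ (κ i) (x i) ≤ modeCost m N Λ (κ i) y := by
  refine h.le_update i hy (le_trans (Finset.card_le_card fun k hk => ?_) h.card_le)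
  rcases eq_or_ne k i with rfl | hki
  · simpa using hi
  · simpa [Function.update_of_ne hki] using hk

/-- Activating a mode strictly above the threshold lowers the cost, and a free slot permits it. -/
theorem ne_zero_of_room (h : IsOptimalSpectrum m r N Λ κ x) (hN : 0 < N) (hΛ : 0 < Λ)
    {i : Fin K} (hc : (Finset.univ.filter fun k => x k ≠ 0).card < r)
    (ht : Λ * ((m + 1 : ℕ) : ℝ) ^ 2 * N < κ i ^ 2 * theta m) : x i ≠ 0 := by
  intro h0
  obtain ⟨y, hy, hlt⟩ := exists_modeCost_lt hN hΛ ht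
  have h1 := h.le_update i hy.le (by
    refine le_trans (Finset.card_le_card (t := insert i (Finset.univ.filter fun k => x k ≠ 0))
      fun k hk => ?_) ((Finset.card_insert_le _ _).trans hc)
    rcases eq_or_ne k i with rfl | hki
    · simp
    · rw [Finset.mem_insert]
      right
      simpa [Function.update_of_ne hki] using hk)
  rw [h0] at h1
  exact absurd h1 (not_le.2 hlt)

/-- Otherwise swapping the values at `i` and `j` keeps the number of active modes and lowers the
total cost. -/
theorem ne_zero_of_lt (h : IsOptimalSpectrum m r N Λ κ x) (hN : 0 < N) (hκ : ∀ i, 0 ≤ κ i)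
    {i j : Fin K} (hi : x i ≠ 0) (hij : κ i < κ j) : x j ≠ 0 := by
  intro hj
  have hne : i ≠ j := fun e => hij.ne (congrArg κ e)
  let y : Fin K → ℝ := x ∘ Equiv.swap i j
  have hcard : (Finset.univ.filter fun k => y k ≠ 0).card ≤ r := by
    refine le_trans (le_of_eq ?_) h.card_le
    refine Finset.card_equiv (Equiv.swap i j) fun k => ?_
    simp [y]
  have h1 := h.le y (fun k => h.nonneg _) hcard
  rw [← sub_nonneg, ← Finset.sum_sub_distrib, Fintype.sum_eq_add i j hne] at h1
  · simp only [y, Function.comp_apply, Equiv.swap_apply_left, Equiv.swap_apply_right, hj] at h1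
    have h2 := modeCost_swap_lt (m := m) (Λ := Λ) hN (hκ i) hij
      (lt_of_le_of_ne (h.nonneg i) (Ne.symm hi))
    linarith
  · rintro k ⟨h2, h3⟩
    simp only [y, Function.comp_apply, Equiv.swap_apply_of_ne_of_ne h2 h3, sub_self]

theorem pos (h : IsOptimalSpectrum m r N Λ κ x) {i : Fin K} (hi : x i ≠ 0) : 0 < x i :=
  lt_of_le_of_ne (h.nonneg i) (Ne.symm hi)

theorem thresh_le (h : IsOptimalSpectrum m r N Λ κ x) (hN : 0 < N) {i : Fin K} (hi : x i ≠ 0) :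
    Λ * ((m + 1 : ℕ) : ℝ) ^ 2 * N ≤ κ i ^ 2 * theta m :=
  thresh_of_modeCost_le hN (h.pos hi) (h.minimizes hi 0 le_rfl)

theorem largestRoot (h : IsOptimalSpectrum m r N Λ κ x) (hN : 0 < N) (hΛ : 0 < Λ) {i : Fin K}
    (hi : x i ≠ 0) : IsLargestRoot (m + 1) (N / κ i ^ 2 * Λ) (x i) :=
  largestRoot_of_minimizer hN hΛ (h.pos hi) (h.minimizes hi)

theorem ne_zero_of_le (h : IsOptimalSpectrum m r N Λ κ x) (hN : 0 < N) (hκ : ∀ i, 0 ≤ κ i)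
    (hanti : Antitone κ) (htie : ∀ i j, i ≤ j → κ i = κ j → x j ≤ x i) {i j : Fin K}
    (hij : i ≤ j) (hj : x j ≠ 0) : x i ≠ 0 := by
  rcases (hanti hij).lt_or_eq with h1 | h1
  · exact h.ne_zero_of_lt hN hκ hj h1
  · exact ((h.pos hj).trans_le (htie i j hij h1.symm)).ne'

/-- The active modes form an initial segment: the exchange argument handles distinct singular
values, `htie` equal ones. At most `r` of them are active. -/
theorem lt_of_ne_zero (h : IsOptimalSpectrum m r N Λ κ x) (hN : 0 < N) (hκ : ∀ i, 0 ≤ κ i)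
    (hanti : Antitone κ) (htie : ∀ i j, i ≤ j → κ i = κ j → x j ≤ x i) {k : Fin K}
    (hk : x k ≠ 0) : (k : ℕ) < r := by
  have h1 : Finset.Iic k ⊆ Finset.univ.filter fun i => x i ≠ 0 := fun i hi => by
    simpa using h.ne_zero_of_le hN hκ hanti htie (Finset.mem_Iic.1 hi) hk
  have h2 := (Finset.card_le_card h1).trans h.card_le
  rwa [Fin.card_Iic] at h2

/-- If mode `k` were inactive, all active ones would lie before `k`, so fewer than `r` slots would
be in use. -/
theorem ne_zero_of_thresh_lt (h : IsOptimalSpectrum m r N Λ κ x) (hN : 0 < N) (hΛ : 0 < Λ)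
    (hκ : ∀ i, 0 ≤ κ i) (hanti : Antitone κ)
    (htie : ∀ i j, i ≤ j → κ i = κ j → x j ≤ x i) {k : Fin K} (hk : (k : ℕ) < r)
    (ht : Λ * ((m + 1 : ℕ) : ℝ) ^ 2 * N < κ k ^ 2 * theta m) : x k ≠ 0 := by
  intro h0
  have h1 : (Finset.univ.filter fun i => x i ≠ 0) ⊆ Finset.Iio k := fun i hi => by
    rw [Finset.mem_Iio]
    by_contra! hki
    exact h.ne_zero_of_le hN hκ hanti htie hki (by simpa using hi) h0
  have h2 := Finset.card_le_card h1
  rw [Fin.card_Iio] at h2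
  exact h.ne_zero_of_room hN hΛ (h2.trans_lt hk) ht h0

end IsOptimalSpectrum

end Optimal

/-! ### Translation into the stated geometry -/

section Geometry

variable {m : ℕ} {d : ℕ → ℕ} {n : Fin (d (m + 1)) → ℕ} {lamW : Fin (m + 1) → ℝ} {lamH : ℝ}
  {W : Layers (m + 1) d} {H : Matrix (Fin (d 0)) (Samples n) ℝ}
  {U V : Matrix (Fin (d (m + 1))) (Fin (d (m + 1))) ℝ} {κ x : Fin (d (m + 1)) → ℝ}

/-- The factor `(N λ_H / c)^{1/L}`. -/
noncomputable def scale (n : Fin (d (m + 1)) → ℕ) (lamW : Fin (m + 1) → ℝ) (lamH : ℝ) : ℝ :=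
  (total n * lamH / cConst lamW) ^ (1 / ((m + 1 : ℕ) : ℝ))

theorem cConst_pos (hW : ∀ j, 0 < lamW j) : 0 < cConst lamW :=
  div_pos (pow_pos (hW 0) m) (Finset.prod_pos fun j _ => hW j.succ)

theorem rpow_one_div_pow {y : ℝ} (hy : 0 ≤ y) (m : ℕ) :
    (y ^ (1 / ((m + 1 : ℕ) : ℝ))) ^ (m + 1) = y := by
  rw [← Real.rpow_natCast, ← Real.rpow_mul hy, one_div, inv_mul_cancel₀ (by positivity),
    Real.rpow_one]

theorem rootLam_pos (hN : 0 < total n) (hW : ∀ j, 0 < lamW j) (hH : 0 < lamH) :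
    0 < rootLam n lamW lamH :=
  Real.rpow_pos_of_pos (mul_pos (mul_pos hN (Finset.prod_pos fun j _ => hW j)) hH) _

theorem rootLam_pow (hN : 0 < total n) (hW : ∀ j, 0 < lamW j) (hH : 0 < lamH) :
    rootLam n lamW lamH ^ (m + 1) = total n * (∏ j, lamW j) * lamH :=
  rpow_one_div_pow (mul_pos (mul_pos hN (Finset.prod_pos fun j _ => hW j)) hH).le m

theorem scale_pos (hN : 0 < total n) (hW : ∀ j, 0 < lamW j) (hH : 0 < lamH) :
    0 < scale n lamW lamH :=
  Real.rpow_pos_of_pos (div_pos (mul_pos hN hH) (cConst_pos hW)) _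

theorem cConst_mul_scale_pow (hN : 0 < total n) (hW : ∀ j, 0 < lamW j) (hH : 0 < lamH) :
    cConst lamW * scale n lamW lamH ^ (m + 1) = total n * lamH := by
  rw [scale, rpow_one_div_pow (div_pos (mul_pos hN hH) (cConst_pos hW)).le,
    mul_div_cancel₀ _ (cConst_pos hW).ne']

/-- Seen by comparing `L`-th powers. This identity and `cConst_mul_scale_pow` match the
normalization `x` with `σ² = scale * x`. -/
theorem lam_mul_scale (hN : 0 < total n) (hW : ∀ j, 0 < lamW j) (hH : 0 < lamH) :
    lamW 0 * scale n lamW lamH = rootLam n lamW lamH := by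
  refine (pow_left_inj₀ (n := m + 1) (mul_pos (hW 0) (scale_pos hN hW hH)).le
    (rootLam_pos hN hW hH).le (Nat.succ_ne_zero m)).1 ?_
  rw [rootLam_pow hN hW hH, mul_pow]
  have h1 := cConst_mul_scale_pow (lamW := lamW) hN hW hH
  have hp : ∏ j : Fin m, lamW j.succ ≠ 0 :=
    Finset.prod_ne_zero_iff.2 fun j _ => (hW j.succ).ne'
  rw [cConst, div_mul_eq_mul_div, div_eq_iff hp] at h1
  rw [Fin.prod_univ_succ, pow_succ]
  linear_combination lamW 0 * h1

/-- The rows of `Uᵀ P` are orthogonal with squared norms `N λ_H x_k^L`, and the `k`-th column of `H̄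
D V` is a nonnegative multiple `D k` of the `k`-th row. The Gram identities, the alignment and the
vanishing all follow from this. -/
theorem hasGeometry_of_spectralForm (hN : 0 < total n) (hW : ∀ j, 0 < lamW j) (hH : 0 < lamH)
    (hx : ∀ i, 0 ≤ x i) (hsvd : IsSVD (centeredLabels n) U κ V)
    (hκ : ∀ i, x i ≠ 0 → κ i ≠ 0)
    (hq : Uᵀ * (lastLayer W * (lastLayer W)ᵀ) * U
      = diagonal fun i => rootLam n lamW lamH * x i / lamW (Fin.last m))
    (h : SpectralForm (total n) lamH (rootLam n lamW lamH) lamW W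
      (classMeans H * sqrtCounts n) U κ V x) :
    HasGeometry lamW lamH W H U κ V {k | x k ≠ 0} fun k => scale n lamW lamH * x k := by
  have hν : 0 < total n * lamH := mul_pos hN hH
  have hX : ∀ i, 0 < x i ^ (m + 1) + 1 := fun i =>
    add_pos_of_nonneg_of_pos (pow_nonneg (hx i) _) one_pos
  have hcs : ∀ i, cConst lamW * (scale n lamW lamH * x i) ^ (m + 1)
      = total n * lamH * x i ^ (m + 1) := fun i => by
    rw [mul_pow, ← mul_assoc, cConst_mul_scale_pow hN hW hH]
  have hquot : ∀ i, cConst lamW * ((scale n lamW lamH * x i) ^ (m + 1)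
      / (cConst lamW * (scale n lamW lamH * x i) ^ (m + 1) + total n * lamH) ^ 2)
      = total n * lamH * x i ^ (m + 1)
        / (total n * lamH * x i ^ (m + 1) + total n * lamH) ^ 2 := fun i => by
    rw [← mul_div_assoc, hcs]
  have hVtV : Vᵀ * V = 1 := (mem_orthogonalGroup_iff' _ ℝ).1 hsvd.right_orth
  set P := layerProd W with hP
  set D : Fin (d (m + 1)) → ℝ :=
    fun i => κ i / (total n * lamH * (x i ^ (m + 1) + 1)) with hD
  have hprod : Uᵀ * (P * Pᵀ) * U = diagonal fun i => total n * lamH * x i ^ (m + 1) := h.prod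
  have hGV : classMeans H * sqrtCounts n * V = Pᵀ * U * diagonal D := by
    rw [h.feat, Matrix.mul_assoc _ Vᵀ, hVtV, Matrix.mul_one]
  have hrow : ∀ k, ∑ a, (Uᵀ * P) k a ^ 2 = total n * lamH * x k ^ (m + 1) := by
    intro k
    have h1 : Uᵀ * (P * Pᵀ) * U = (Uᵀ * P) * (Uᵀ * P)ᵀ := by
      rw [transpose_mul, transpose_transpose]; simp only [Matrix.mul_assoc]
    have h2 := congrFun (congrFun (h1.symm.trans hprod) k) k
    rw [diagonal_apply_eq, Matrix.mul_apply] at h2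
    rw [← h2]
    exact Finset.sum_congr rfl fun a _ => sq _
  have hcol : ∀ k a, (classMeans H * sqrtCounts n * V) a k = D k * (Uᵀ * P) k a := by
    intro k a
    rw [hGV, mul_diagonal, mul_comm]
    congr 1
    rw [← transpose_apply (Pᵀ * U), transpose_mul, transpose_transpose]
  refine ⟨?_, ?_, ?_, ?_, ?_, ?_⟩
  · rw [hq, upsilonOne, ← diagonal_smul]
    congr 1
    funext i
    simp only [Pi.smul_apply, smul_eq_mul]
    rw [← lam_mul_scale hN hW hH]
    ring
  · rw [← hP, hprod, upsilonOne, diagonal_pow, ← diagonal_smul]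
    congr 1
    funext i
    simp only [Pi.smul_apply, Pi.pow_apply, smul_eq_mul]
    rw [hcs]
  · rw [hGV]
    have h1 : (Pᵀ * U * diagonal D)ᵀ * (Pᵀ * U * diagonal D)
        = diagonal D * (Uᵀ * (P * Pᵀ) * U) * diagonal D := by
      simp only [transpose_mul, transpose_transpose, diagonal_transpose, Matrix.mul_assoc]
    rw [h1, hprod, diagonal_mul_diagonal, diagonal_mul_diagonal, upsilonTwo, diagonal_pow,
      diagonal_mul_diagonal, ← diagonal_smul]
    congr 1
    funext i
    simp only [Pi.smul_apply, Pi.pow_apply, smul_eq_mul]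
    rw [← mul_assoc (cConst lamW), hquot]
    simp only [hD]
    have := hX i
    field_simp
  · rw [hGV, ← hP]
    have h1 : Uᵀ * P * (Pᵀ * U * diagonal D) = (Uᵀ * (P * Pᵀ) * U) * diagonal D := by
      simp only [Matrix.mul_assoc]
    have h2 : (total n * lamH) • (1 : Matrix (Fin (d (m + 1))) (Fin (d (m + 1))) ℝ)
        = diagonal fun _ => total n * lamH := by
      rw [← diagonal_one, ← diagonal_smul]
      congr 1
      funext i
      simp
    rw [h1, hprod, diagonal_mul_diagonal, upsilonTwo, upsilonOne, diagonal_pow, h2,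
      ← diagonal_smul, diagonal_add, diagonal_mul_diagonal, diagonal_mul_diagonal,
      ← diagonal_smul]
    congr 1
    funext i
    simp only [Pi.smul_apply, Pi.pow_apply, smul_eq_mul]
    rw [← mul_assoc (cConst lamW), ← mul_assoc (cConst lamW), hquot, hcs]
    simp only [hD]
    have := hX i
    field_simp
  · rintro k hk w g rfl rfl
    have hk' : x k ≠ 0 := hk
    have hxk : 0 < x k := lt_of_le_of_ne (hx k) (Ne.symm hk')
    have hκk : 0 < κ k := lt_of_le_of_ne (hsvd.nonneg k) (Ne.symm (hκ k hk'))
    have hDk : 0 < D k := div_pos hκk (mul_pos hν (hX k))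
    set w : EuclideanSpace ℝ (Fin (d 0)) := WithLp.toLp 2 fun a => (Uᵀ * P) k a with hw
    have hg : (WithLp.toLp 2 fun a => (classMeans H * sqrtCounts n * V) a k :
        EuclideanSpace ℝ (Fin (d 0))) = D k • w := by
      ext a
      simp [hcol, hw]
    have hw0 : w ≠ 0 := by
      intro h0
      have h1 : ∑ a, (Uᵀ * P) k a ^ 2 = 0 := Finset.sum_eq_zero fun a _ => by
        have : (Uᵀ * P) k a = w a := rfl
        rw [this, h0]; simp
      rw [hrow] at h1
      have : 0 < total n * lamH * x k ^ (m + 1) := by positivity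
      exact this.ne' h1
    rw [hg]
    refine ⟨hw0, smul_ne_zero hDk.ne' hw0, ?_⟩
    rw [norm_smul, Real.norm_of_nonneg hDk.le, smul_smul, mul_inv, mul_right_comm,
      inv_mul_cancel₀ hDk.ne', one_mul]
  · intro k hk a
    have hk' : x k = 0 := not_not.1 hk
    have h1 := hrow k
    rw [hk', zero_pow (Nat.succ_ne_zero m), mul_zero] at h1
    have h2 := (Finset.sum_eq_zero_iff_of_nonneg fun a _ => sq_nonneg _).1 h1 a
      (Finset.mem_univ a)
    have h3 : (Uᵀ * P) k a = 0 := by simpa using h2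
    exact ⟨h3, by rw [hcol, h3, mul_zero]⟩

theorem threshLeft_eq : threshLeft n lamW lamH
    = rootLam n lamW lamH * ((m + 1 : ℕ) : ℝ) ^ 2 * total n := rfl

/-- A matrix that is diagonal in the left frame of one singular value decomposition, with entries
depending only on the singular values, is diagonal in every such frame. -/
theorem IsSVD.diagonal_of_diagonal {K : ℕ} {A U V U' V' Q : Matrix (Fin K) (Fin K) ℝ}
    {κ q : Fin K → ℝ} (h : IsSVD A U κ V) (h' : IsSVD A U' κ V') (hq : Uᵀ * Q * U = diagonal q)
    (htie : ∀ i j, κ i = κ j → q i = q j) : U'ᵀ * Q * U' = diagonal q := by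
  have h1 : Uᵀ * U = 1 := (mem_orthogonalGroup_iff' _ ℝ).1 h.left_orth
  have h2 : U * Uᵀ = 1 := (mem_orthogonalGroup_iff _ ℝ).1 h.left_orth
  have h3 : U'ᵀ * U' = 1 := (mem_orthogonalGroup_iff' _ ℝ).1 h'.left_orth
  set O := U'ᵀ * U with hO
  -- Both frames diagonalize `A Aᵀ` with the same values, so the transition matrix `O` mixes only
  -- indices with equal `κ`. By `htie` it then commutes with `diagonal q` too.
  have hcomm : diagonal (fun i => κ i ^ 2) * O = O * diagonal fun i => κ i ^ 2 := by
    have e := h.gram.symm.trans h'.gram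
    calc diagonal (fun i => κ i ^ 2) * O
        = (U'ᵀ * U') * diagonal (fun i => κ i ^ 2) * U'ᵀ * U := by
          rw [h3, Matrix.one_mul, hO, Matrix.mul_assoc]
      _ = U'ᵀ * (U' * diagonal (fun i => κ i ^ 2) * U'ᵀ) * U := by simp only [Matrix.mul_assoc]
      _ = U'ᵀ * (U * diagonal (fun i => κ i ^ 2) * Uᵀ) * U := by rw [e]
      _ = U'ᵀ * U * diagonal (fun i => κ i ^ 2) * (Uᵀ * U) := by simp only [Matrix.mul_assoc]
      _ = _ := by rw [h1, Matrix.mul_one]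
  have hcomm' : diagonal q * O = O * diagonal q := by
    ext i j
    have e := congrFun (congrFun hcomm i) j
    rw [diagonal_mul, mul_diagonal] at e ⊢
    by_cases hz : O i j = 0
    · simp [hz]
    · have e1 : κ i ^ 2 = κ j ^ 2 := by
        have : (κ i ^ 2 - κ j ^ 2) * O i j = 0 := by linear_combination e
        exact sub_eq_zero.1 ((mul_eq_zero.1 this).resolve_right hz)
      have e2 := (pow_left_inj₀ (h.nonneg i) (h.nonneg j) two_ne_zero).1 e1
      rw [htie i j e2, mul_comm]
  have hQ : Q = U * diagonal q * Uᵀ := by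
    rw [← hq]
    calc Q = (U * Uᵀ) * Q * (U * Uᵀ) := by rw [h2]; simp
      _ = _ := by simp only [Matrix.mul_assoc]
  calc U'ᵀ * Q * U' = O * diagonal q * (Uᵀ * U') := by rw [hQ, hO]; simp only [Matrix.mul_assoc]
    _ = diagonal q * (U'ᵀ * (U * Uᵀ) * U') := by
      rw [← hcomm', hO]; simp only [Matrix.mul_assoc]
    _ = diagonal q := by rw [h2, Matrix.mul_one, h3, Matrix.mul_one]

variable {b : Fin (d (m + 1)) → ℝ}

/-- A minimizer has an optimal spectrum with respect to some singular value decomposition of the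
centered labels, in which active modes precede inactive ones with the same singular value. -/
theorem exists_optimal_svd (hn : ∀ k, 0 < n k) (hN : 0 < total n) (hW : ∀ j, 0 < lamW j)
    (hH : 0 < lamH) (hmin : IsGlobalMinimizer n lamW lamH W H b) :
    ∃ U κ V x, IsSVD (centeredLabels n) U κ V ∧
      Uᵀ * (lastLayer W * (lastLayer W)ᵀ) * U
        = diagonal (fun i => rootLam n lamW lamH * x i / lamW (Fin.last m)) ∧
      IsOptimalSpectrum m (minWidth (m + 1) d) (total n) (rootLam n lamW lamH) κ x ∧
      ∀ i j, i ≤ j → κ i = κ j → x j ≤ x i := by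
  have hcore := core_min hn hN hH hmin
  have hΛ := rootLam_pos hN hW hH
  have hΛL := rootLam_pow hN hW hH
  have hl := hW (Fin.last m)
  obtain ⟨U, κ, V, q, hsvd, hq, htie⟩ := exists_joint_svd
    (by simpa using isHermitian_mul_conjTranspose_self (lastLayer W))
    (commute_last_gram hN hH hW hcore)
  -- The eigenvalues of the last Gram matrix, rescaled to the variable of `modeCost`.
  set x := fun i => lamW (Fin.last m) * q i / rootLam n lamW lamH with hx
  have hq' : Uᵀ * (lastLayer W * (lastLayer W)ᵀ) * U
      = diagonal (fun i => rootLam n lamW lamH * x i / lamW (Fin.last m)) := by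
    rw [hq]
    congr 1
    funext i
    simp only [hx]
    field_simp
  have hform := spectralForm_of_min hN hH hW hΛ hΛL hcore hsvd hq'
  have hx0 := spectrum_nonneg hΛ hW hq'
  refine ⟨U, κ, V, x, hsvd, hq', ⟨hx0, card_spectrum_le hN hH hform,
    spectrum_optimal hN hH hW hΛ hΛL hcore hsvd hx0 hform⟩, fun i j hij hκ => ?_⟩
  have := htie i j hij hκ
  simp only [hx]
  gcongr

theorem hasGeometry_of_optimal (hn : ∀ k, 0 < n k) (hN : 0 < total n) (hW : ∀ j, 0 < lamW j)
    (hH : 0 < lamH) (hmin : IsGlobalMinimizer n lamW lamH W H b)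
    (hsvd : IsSVD (centeredLabels n) U κ V)
    (hq : Uᵀ * (lastLayer W * (lastLayer W)ᵀ) * U
      = diagonal fun i => rootLam n lamW lamH * x i / lamW (Fin.last m))
    (hopt : IsOptimalSpectrum m (minWidth (m + 1) d) (total n) (rootLam n lamW lamH) κ x) :
    HasGeometry lamW lamH W H U κ V {k | x k ≠ 0} fun k => scale n lamW lamH * x k := by
  have hΛ := rootLam_pos hN hW hH
  refine hasGeometry_of_spectralForm hN hW hH hopt.nonneg hsvd (fun i hi h0 => ?_) hq
    (spectralForm_of_min hN hH hW hΛ (rootLam_pow hN hW hH) (core_min hn hN hH hmin) hsvd hq)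
  -- The threshold is positive, so an active mode cannot have `κ i = 0`.
  have h1 := hopt.thresh_le hN hi
  rw [h0] at h1
  have h2 : 0 < rootLam n lamW lamH * ((m + 1 : ℕ) : ℝ) ^ 2 * total n := by positivity
  simp at h1
  push_cast at h2
  linarith

theorem isSpectrum_of_optimal (hN : 0 < total n) (hW : ∀ j, 0 < lamW j) (hH : 0 < lamH)
    (hκ : ∀ i, 0 ≤ κ i) (hanti : Antitone κ)
    (hopt : IsOptimalSpectrum m (minWidth (m + 1) d) (total n) (rootLam n lamW lamH) κ x)
    (htie : ∀ i j, i ≤ j → κ i = κ j → x j ≤ x i) :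
    IsSpectrum n lamW lamH κ {k | x k ≠ 0} fun k => scale n lamW lamH * x k := by
  have hΛ := rootLam_pos hN hW hH
  refine ⟨fun k hk ht => ?_, fun k hk => hopt.lt_of_ne_zero hN hκ hanti htie hk,
    fun k hk => ?_, fun k hk => ⟨x k, hopt.largestRoot hN hΛ hk, rfl⟩, fun k hk => ?_⟩
  · rw [threshRight_eq, threshLeft_eq] at ht
    exact hopt.ne_zero_of_thresh_lt hN hΛ hκ hanti htie hk ht
  · rw [threshRight_eq, threshLeft_eq]
    exact hopt.thresh_le hN hk
  · have : x k = 0 := not_not.1 hk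
    simp [this]

theorem support_eq_activeSet (hN : 0 < total n) (hW : ∀ j, 0 < lamW j) (hH : 0 < lamH)
    (hopt : IsOptimalSpectrum m (minWidth (m + 1) d) (total n) (rootLam n lamW lamH) κ x)
    (hspec : IsSpectrum n lamW lamH κ {k | x k ≠ 0} fun k => scale n lamW lamH * x k)
    (hne : 1 ≤ m → ∀ k : Fin (d (m + 1)), (k : ℕ) < minWidth (m + 1) d →
      threshLeft n lamW lamH ≠ threshRight (m + 1) (κ k)) :
    {k | x k ≠ 0} = activeSet n lamW lamH κ := by
  ext k
  refine ⟨fun hk => ⟨hspec.lt_width k hk, ?_⟩, fun hk => hspec.mem_of_lt k hk.1 hk.2⟩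
  rcases Nat.eq_zero_or_pos m with rfl | hm
  · rw [threshRight_eq, threshLeft_eq]
    exact thresh_lt_of_modeCost_le hN (rootLam_pos hN hW hH) (hopt.pos hk)
      (hopt.minimizes hk 0 le_rfl)
  · exact lt_of_le_of_ne (hspec.le_thresh k hk) (hne hm k (hspec.lt_width k hk))

/-- The gap condition keeps equal singular values on the same side of the cutoff `r`, hence jointly
active or inactive; among active ones `x` is the unique largest root of an equation in `κ` alone. -/
theorem eq_of_eq_singularValue (hN : 0 < total n) (hW : ∀ j, 0 < lamW j) (hH : 0 < lamH)
    (hopt : IsOptimalSpectrum m (minWidth (m + 1) d) (total n) (rootLam n lamW lamH) κ x)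
    (hact : {k | x k ≠ 0} = activeSet n lamW lamH κ)
    (hgap : ∀ k l : Fin (d (m + 1)), (k : ℕ) < minWidth (m + 1) d →
      minWidth (m + 1) d ≤ (l : ℕ) → threshLeft n lamW lamH < threshRight (m + 1) (κ k) →
      κ l ≠ κ k) (i j : Fin (d (m + 1))) (hij : κ i = κ j) : x i = x j := by
  have hΛ := rootLam_pos hN hW hH
  have hmem : ∀ k, x k ≠ 0 ↔ k ∈ activeSet n lamW lamH κ := fun k => Set.ext_iff.1 hact k
  have key : ∀ i j, κ i = κ j → x i ≠ 0 → x i = x j := by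
    intro i j hij hi
    have hi' := (hmem i).1 hi
    have hj : x j ≠ 0 := by
      refine (hmem j).2 ⟨?_, hij ▸ hi'.2⟩
      by_contra! hr
      exact hgap i j hi'.1 hr hi'.2 hij.symm
    have h1 := hopt.largestRoot hN hΛ hi
    rw [hij] at h1
    exact h1.unique (hopt.largestRoot hN hΛ hj)
  by_cases hi : x i = 0
  · by_cases hj : x j = 0
    · rw [hi, hj]
    · exact (key j i hij.symm hj).symm
  · exact key i j hij hi

end Geometry

/-- Without classes, the spectrum and the geometry carry no information. -/
theorem geometry_of_isEmpty {m : ℕ} {d : ℕ → ℕ} [hE : IsEmpty (Fin (d (m + 1)))]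
    {n : Fin (d (m + 1)) → ℕ} {lamW : Fin (m + 1) → ℝ} {lamH : ℝ} {W : Layers (m + 1) d}
    {H : Matrix (Fin (d 0)) (Samples n) ℝ} (U : Matrix (Fin (d (m + 1))) (Fin (d (m + 1))) ℝ)
    (κ : Fin (d (m + 1)) → ℝ) (V : Matrix (Fin (d (m + 1))) (Fin (d (m + 1))) ℝ)
    (S : Set (Fin (d (m + 1)))) :
    ∃ s, IsSpectrum n lamW lamH κ S s ∧ HasGeometry lamW lamH W H U κ V S s :=
  ⟨fun _ => 0, ⟨fun k => hE.elim k, fun k => hE.elim k, fun k => hE.elim k, fun k => hE.elim k,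
    fun k => hE.elim k⟩, ⟨Subsingleton.elim _ _, Subsingleton.elim _ _, Subsingleton.elim _ _,
    Subsingleton.elim _ _, fun k => hE.elim k, fun k => hE.elim k⟩⟩

end ExtendedUFM

/-! ### Assembly of the three claims -/

theorem mainTheorem2 (m : ℕ) (d : ℕ → ℕ) (n : Fin (d (m + 1)) → ℕ) (hn : ∀ k, 0 < n k)
    (lamW : Fin (m + 1) → ℝ) (hW : ∀ j, 0 < lamW j) (lamH : ℝ) (hH : 0 < lamH)
    (W : ExtendedUFM.Layers (m + 1) d)
    (H : Matrix (Fin (d 0)) (ExtendedUFM.Samples n) ℝ) (b : Fin (d (m + 1)) → ℝ)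
    (hmin : ExtendedUFM.IsGlobalMinimizer n lamW lamH W H b) :
    (∀ (k : Fin (d (m + 1))) (i j : Fin (n k)) (a : Fin (d 0)), H a ⟨k, i⟩ = H a ⟨k, j⟩) ∧
    (∀ (U : Matrix (Fin (d (m + 1))) (Fin (d (m + 1))) ℝ) (κ : Fin (d (m + 1)) → ℝ)
        (V : Matrix (Fin (d (m + 1))) (Fin (d (m + 1))) ℝ),
      ExtendedUFM.IsSVD (ExtendedUFM.centeredLabels n) U κ V →
      (1 ≤ m → ∀ k : Fin (d (m + 1)), (k : ℕ) < ExtendedUFM.minWidth (m + 1) d →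
        ExtendedUFM.threshLeft n lamW lamH ≠ ExtendedUFM.threshRight (m + 1) (κ k)) →
      (∀ k l : Fin (d (m + 1)), (k : ℕ) < ExtendedUFM.minWidth (m + 1) d →
        ExtendedUFM.minWidth (m + 1) d ≤ (l : ℕ) →
        ExtendedUFM.threshLeft n lamW lamH < ExtendedUFM.threshRight (m + 1) (κ k) →
        κ l ≠ κ k) →
      ∃ s : Fin (d (m + 1)) → ℝ,
        ExtendedUFM.IsSpectrum n lamW lamH κ (ExtendedUFM.activeSet n lamW lamH κ) s ∧
        ExtendedUFM.HasGeometry lamW lamH W H U κ V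
          (ExtendedUFM.activeSet n lamW lamH κ) s) ∧
    (∃ (U : Matrix (Fin (d (m + 1))) (Fin (d (m + 1))) ℝ) (κ : Fin (d (m + 1)) → ℝ)
        (V : Matrix (Fin (d (m + 1))) (Fin (d (m + 1))) ℝ)
        (S : Set (Fin (d (m + 1)))) (s : Fin (d (m + 1)) → ℝ),
      ExtendedUFM.IsSVD (ExtendedUFM.centeredLabels n) U κ V ∧
      ExtendedUFM.IsSpectrum n lamW lamH κ S s ∧
      ExtendedUFM.HasGeometry lamW lamH W H U κ V S s) := by
  refine ⟨ExtendedUFM.features_collapse hn hH hmin, ?_⟩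
  -- Positivity of `N` needs at least one class; without classes all the claims about spectra are
  -- vacuous.
  rcases isEmpty_or_nonempty (Fin (d (m + 1))) with hE | ⟨⟨k₀⟩⟩
  · refine ⟨fun U κ V _ _ _ => ExtendedUFM.geometry_of_isEmpty U κ V _, 1, fun _ => 0, 1, ∅, ?_⟩
    obtain ⟨s, h1, h2⟩ := ExtendedUFM.geometry_of_isEmpty (n := n) (lamW := lamW) (lamH := lamH)
      (W := W) (H := H) 1 (fun _ => 0) 1 ∅
    exact ⟨s, ⟨one_mem _, one_mem _, fun _ => le_rfl, fun _ _ _ => le_rfl, Subsingleton.elim _ _⟩,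
      h1, h2⟩
  have hN := ExtendedUFM.total_pos hn k₀
  obtain ⟨U₀, κ₀, V₀, x, hsvd, hq, hopt, htie⟩ :=
    ExtendedUFM.exists_optimal_svd hn hN hW hH hmin
  have hspec := ExtendedUFM.isSpectrum_of_optimal hN hW hH hsvd.nonneg hsvd.antitone hopt htie
  refine ⟨fun U κ V h hne hgap => ?_, U₀, κ₀, V₀, _, _, hsvd, hspec,
    ExtendedUFM.hasGeometry_of_optimal hn hN hW hH hmin hsvd hq hopt⟩
  obtain rfl := hsvd.unique h
  have hact := ExtendedUFM.support_eq_activeSet hN hW hH hopt hspec hne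
  have hties := ExtendedUFM.eq_of_eq_singularValue hN hW hH hopt hact hgap
  -- The special frame is no longer needed: the given one diagonalizes the last Gram matrix with the
  -- same spectrum.
  have hqU := hsvd.diagonal_of_diagonal h hq fun i j hij => by rw [hties i j hij]
  rw [← hact]
  exact ⟨_, hspec, ExtendedUFM.hasGeometry_of_optimal hn hN hW hH hmin h hqU hopt⟩
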